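/- Let $\mathbb D$ be the open unit disc in $\mathbb C$. A radial weight $\omega:[0,1)\to(0,\infty)$, integrable on $[0,1)$, is called regular if it is continuous and there are constants $c,c'>0$ such that $c\,(1-r)\le\frac1{\omega(r)}\int_r^1\omega(s)\,ds\le c'(1-r)$ for all $0\le r<1$. For $f$ analytic in $\mathbb D$ and $0<q<\infty$ put $$M_q(r,f)=\Big(\frac1{2\pi}\int_0^{2\pi}|f(re^{i\theta})|^q\,d\theta\Big)^{1/q},\qquad \|f\|_{H^q}=\lim_{r\to1^-}M_q(r,f).$$ Let $1<q<\infty$, $0<p<\infty$, $0\le\gamma<\infty$, and let $\omega$ be a regular weight with $\int_0^1\omega(r)\,dr=1$. For $n=0,1,2,\dots$ let $r_n\in[0,1)$ be the unique point with $\int_{r_n}^1\omega(r)\,dr=2^{-n}$, and let $M_n=\big\lfloor\frac1{1-r_n}\big\rfloor$. Put $I(0)=\{k\in\mathbb N\cup\{0\}:k<M_1\}$ and $I(n)=\{k\in\mathbb N:M_n\le k<M_{n+1}\}$ for $n\ge1$, and for $g(z)=\sum_{k=0}^\infty a_kz^k$ analytic in $\mathbb D$ put $\Delta_n^\omega g(z)=\sum_{k\in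 I(n)}a_kz^k$. Then there is a constant $C>0$, depending only on $q,p,\gamma$ and $\omega$, such that for every $g$ analytic in $\mathbb D$ the mixed norm $$\|g\|^p_{H(q,p,\omega_\gamma)}=\int_0^1M_q^p(r,g)(1-r)^\gamma\omega(r)\,dr$$ satisfies $$\frac1C\sum_{n=0}^\infty2^{-n}\frac{\|\Delta_n^\omega g\|_{H^q}^p}{M_n^\gamma}\le\|g\|^p_{H(q,p,\omega_\gamma)}\le C\sum_{n=0}^\infty2^{-n}\frac{\|\Delta_n^\omega g\|_{H^q}^p}{M_n^\gamma},$$ where both quantities take values in $[0,\infty]$; in particular, one is finite if and only if the other is. -/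

import Mathlib

open MeasureTheory Filter Topology Set
open scoped ENNReal

noncomputable section

namespace MixedNorm

/-- The tail integral `∫_r^1 ω(s) ds` of a radial weight. -/
def tail (ω : ℝ → ℝ) (r : ℝ) : ℝ := ∫ s in r..1, ω s

/-- The distortion function `ψ_ω(r) = (1 / ω(r)) ∫_r^1 ω(s) ds`. -/
def distortion (ω : ℝ → ℝ) (r : ℝ) : ℝ := 1 / ω r * tail ω r

/-- Regular radial weights: positive, continuous and integrable on `[0,1)`, with distortion
function comparable to `1 - r` on `[0,1)`. Values of `ω` outside `[0,1)` are irrelevant. -/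
structure IsRegularWeight (ω : ℝ → ℝ) : Prop where
  pos : ∀ r ∈ Ico (0 : ℝ) 1, 0 < ω r
  continuousOn : ContinuousOn ω (Ico (0 : ℝ) 1)
  integrableOn : IntegrableOn ω (Ico (0 : ℝ) 1)
  distortion_comparable : ∃ c C : ℝ, 0 < c ∧ 0 < C ∧
    ∀ r ∈ Ico (0 : ℝ) 1, c * (1 - r) ≤ distortion ω r ∧ distortion ω r ≤ C * (1 - r)

/-- The integral mean `M_q(r, f)`, for `0 < q < ∞`. -/
def integralMean (q : ℝ) (r : ℝ) (f : ℂ → ℂ) : ℝ :=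
  (1 / (2 * Real.pi) *
    ∫ θ in (0 : ℝ)..(2 * Real.pi), ‖f (r * Complex.exp (θ * Complex.I))‖ ^ q) ^ (1 / q)

/-- The Hardy norm `lim_{r → 1⁻} M_q(r, f)`, with values in `[0, ∞]`. -/
def hardyNorm (q : ℝ) (f : ℂ → ℂ) : ℝ≥0∞ :=
  limUnder (𝓝[<] (1 : ℝ)) (fun r => ENNReal.ofReal (integralMean q r f))

/-- The integral `∫_0^1 M_q(r,g)^p (1 - r)^γ ω(r) dr`, with values in `[0, ∞]`. -/
def mixedIntegral (q p γ : ℝ) (ω : ℝ → ℝ) (g : ℂ → ℂ) : ℝ≥0∞ :=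
  ∫⁻ r in Ioo (0 : ℝ) 1, ENNReal.ofReal (integralMean q r g ^ p * (1 - r) ^ γ * ω r)

/-- The norm of `g` in the mixed norm space `H(q, p, ω_γ)`, where `ω_γ(r) = (1 - r)^γ ω(r)`;
it is `∞` when `g` is not in the space. -/
def mixedNorm (q p γ : ℝ) (ω : ℝ → ℝ) (g : ℂ → ℂ) : ℝ≥0∞ :=
  mixedIntegral q p γ ω g ^ (1 / p)

/-- The point `r_n ∈ [0,1)` with `∫_{r_n}^1 ω = 2^{-n}`. For a regular weight of total mass one
there is exactly one such point, see `rSeq_mem`, `tail_rSeq` and `eq_rSeq`. -/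
def rSeq (ω : ℝ → ℝ) (n : ℕ) : ℝ := sInf {r : ℝ | r ∈ Ico (0 : ℝ) 1 ∧ tail ω r = 1 / 2 ^ n}

/-- `M_n`, the integer part of `1 / (1 - r_n)`. -/
def blockIndex (ω : ℝ → ℝ) (n : ℕ) : ℕ := ⌊1 / (1 - rSeq ω n)⌋₊

/-- `I(0) = {k : k < M_1}` and `I(n) = {k : M_n ≤ k < M_{n+1}}` for `n ≥ 1`. -/
def block (ω : ℝ → ℝ) (n : ℕ) : Finset ℕ :=
  if n = 0 then Finset.range (blockIndex ω 1)
  else Finset.Ico (blockIndex ω n) (blockIndex ω (n + 1))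

/-- The `k`-th Maclaurin coefficient. -/
def maclaurinCoeff (g : ℂ → ℂ) (k : ℕ) : ℂ := iteratedDeriv k g 0 / (Nat.factorial k : ℂ)

/-- The polynomial `Δ_n^ω g(z) = ∑_{k ∈ I(n)} a_k z^k`, where `g(z) = ∑ a_k z^k`. -/
def blockPoly (ω : ℝ → ℝ) (n : ℕ) (g : ℂ → ℂ) (z : ℂ) : ℂ :=
  ∑ k ∈ block ω n, maclaurinCoeff g k * z ^ k

/-- The series `∑_n 2^{-n} ‖Δ_n^ω g‖_{H^q}^p / M_n^γ`, with values in `[0, ∞]`. -/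
def blockSum (q p γ : ℝ) (ω : ℝ → ℝ) (g : ℂ → ℂ) : ℝ≥0∞ :=
  ∑' n : ℕ, (2 : ℝ≥0∞)⁻¹ ^ n * (hardyNorm q (blockPoly ω n g) ^ p / (blockIndex ω n : ℝ≥0∞) ^ γ)

theorem IsRegularWeight.intervalIntegrable {ω : ℝ → ℝ} (h : IsRegularWeight ω) {a b : ℝ}
    (ha : a ∈ Icc (0 : ℝ) 1) (hb : b ∈ Icc (0 : ℝ) 1) : IntervalIntegrable ω volume a b := by
  have h1 : IntegrableOn ω (Icc (0 : ℝ) 1) := by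
    rw [integrableOn_Icc_iff_integrableOn_Ico]; exact h.integrableOn
  have h2 : uIcc a b ⊆ Icc (0 : ℝ) 1 := uIcc_subset_Icc ha hb
  exact (h1.mono_set h2).intervalIntegrable

theorem IsRegularWeight.tail_strictAntiOn {ω : ℝ → ℝ} (h : IsRegularWeight ω) :
    StrictAntiOn (tail ω) (Icc (0 : ℝ) 1) := by
  intro a ha b hb hab
  have hs : (∫ s in a..b, ω s) + tail ω b = tail ω a :=
    intervalIntegral.integral_add_adjacent_intervals (h.intervalIntegrable ha hb)
      (h.intervalIntegrable hb ⟨zero_le_one, le_rfl⟩)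
  have hp : 0 < ∫ s in a..b, ω s := by
    refine intervalIntegral.intervalIntegral_pos_of_pos_on (h.intervalIntegrable ha hb) ?_ hab
    intro x hx
    exact h.pos x ⟨ha.1.trans hx.1.le, hx.2.trans_le hb.2⟩
  linarith

theorem IsRegularWeight.exists_tail_eq {ω : ℝ → ℝ} (h : IsRegularWeight ω)
    (h1 : ∫ r in (0 : ℝ)..1, ω r = 1) (n : ℕ) :
    ∃ r ∈ Ico (0 : ℝ) 1, tail ω r = 1 / 2 ^ n := by
  have hc : ContinuousOn (tail ω) (Icc (0 : ℝ) 1) := by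
    have hI : IntegrableOn ω (uIcc (0 : ℝ) 1) := by
      rw [uIcc_of_le zero_le_one, integrableOn_Icc_iff_integrableOn_Ico]; exact h.integrableOn
    have := intervalIntegral.continuousOn_primitive_interval_left hI
    rwa [uIcc_of_le zero_le_one] at this
  have hpos : (0 : ℝ) < 1 / 2 ^ n := by positivity
  have hle : (1 : ℝ) / 2 ^ n ≤ 1 := by
    rw [div_le_one (by positivity)]; exact one_le_pow₀ (by norm_num)
  have ht1 : tail ω 1 = 0 := by simp [tail]
  have ht0 : tail ω 0 = 1 := h1
  obtain ⟨r, hr, hrn⟩ := intermediate_value_Icc' zero_le_one hc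
    (show (1 : ℝ) / 2 ^ n ∈ Icc (tail ω 1) (tail ω 0) from ⟨by rw [ht1]; exact hpos.le,
      by rw [ht0]; exact hle⟩)
  refine ⟨r, ⟨hr.1, lt_of_le_of_ne hr.2 ?_⟩, hrn⟩
  rintro rfl
  rw [ht1] at hrn
  exact hpos.ne hrn

theorem IsRegularWeight.eq_rSeq {ω : ℝ → ℝ} (h : IsRegularWeight ω) {n : ℕ} {r : ℝ}
    (hr : r ∈ Ico (0 : ℝ) 1) (hrn : tail ω r = 1 / 2 ^ n) : r = rSeq ω n := by
  have hset : {s : ℝ | s ∈ Ico (0 : ℝ) 1 ∧ tail ω s = 1 / 2 ^ n} = {r} := by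
    ext s
    constructor
    · rintro ⟨hs, hsn⟩
      exact h.tail_strictAntiOn.injOn ⟨hs.1, hs.2.le⟩ ⟨hr.1, hr.2.le⟩ (hsn.trans hrn.symm)
    · rintro rfl
      exact ⟨hr, hrn⟩
  rw [rSeq, hset, csInf_singleton]

theorem IsRegularWeight.rSeq_mem {ω : ℝ → ℝ} (h : IsRegularWeight ω)
    (h1 : ∫ r in (0 : ℝ)..1, ω r = 1) (n : ℕ) : rSeq ω n ∈ Ico (0 : ℝ) 1 := by
  obtain ⟨r, hr, hrn⟩ := h.exists_tail_eq h1 n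
  rwa [← h.eq_rSeq hr hrn]

theorem IsRegularWeight.tail_rSeq {ω : ℝ → ℝ} (h : IsRegularWeight ω)
    (h1 : ∫ r in (0 : ℝ)..1, ω r = 1) (n : ℕ) : tail ω (rSeq ω n) = 1 / 2 ^ n := by
  obtain ⟨r, hr, hrn⟩ := h.exists_tail_eq h1 n
  rwa [← h.eq_rSeq hr hrn]

end MixedNorm

end

/-! Regularity of the weight makes 1 - r_n shrink by factors bounded away from 1 and from infinity
at each step, so M_n is comparable to 1/(1 - r_n) and the blocks are essentially lacunary. Cut (0,1)
into the annuli [r_m, r_{m+1}), each of ω-mass 2^{-m-1}, and compare annuli with blocks.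

For the bound of the block sum, partial sum operators are bounded on L^q of a circle because q > 1,
so the circular norm of a block is at most a constant times M_q(r,g). If r lies in [r_{n+1},
r_{n+2}), then r^{M_{n+1}} is bounded below, so the norm of the block at radius r dominates its
Hardy norm, while (1-r)^γ dominates M_n^{-γ}. Integrating over disjoint annuli gives
`exists_blockSum_le`.

For the bound of the integral, the triangle inequality gives M_q(r,g) ≤ Σ_n r^{M_n-1} ‖Δ_n g‖. On
the m-th annulus the factor r^{M_n-1} is doubly exponentially small in n - m when n > m, and for n <
m the weight 2^{-m} M_m^{-γ} is smaller than the one at n by at least 2^{n-m}. The resulting matrix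
decays geometrically off the diagonal (`exists_kernel_bound`), hence is bounded on ℓ^p for every p >
0 (`exists_tsum_convolution_rpow_le`); this is `exists_mixedIntegral_le`.

The boundedness of partial sums is derived from M. Riesz's inequality between f and Re f, itself
obtained by comparing Laplacians: a suitable combination of powers of |f|² + ε and (Re f)² is
subharmonic, so its circular means are at least its value at 0. -/

/-! ### Subharmonic functions and the growth of circular means. -/

/-- `Φ` has first and second derivatives `Φ₁`, `Φ₂` in the direction `e`, all continuous. -/
structure HasTwoDerivs (e : ℂ) (Φ Φ₁ Φ₂ : ℂ → ℝ) : Prop where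
  cont : Continuous Φ
  cont₁ : Continuous Φ₁
  cont₂ : Continuous Φ₂
  deriv₁ : ∀ z, HasDerivAt (fun s : ℝ => Φ (z + s * e)) (Φ₁ z) 0
  deriv₂ : ∀ z, HasDerivAt (fun s : ℝ => Φ₁ (z + s * e)) (Φ₂ z) 0

theorem hasDerivAt_line {e : ℂ} {Φ Φ₁ : ℂ → ℝ}
    (h : ∀ z, HasDerivAt (fun s : ℝ => Φ (z + s * e)) (Φ₁ z) 0) (z : ℂ) (t : ℝ) :
    HasDerivAt (fun s : ℝ => Φ (z + s * e)) (Φ₁ (z + t * e)) t := by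
  have h1 := h (z + t * e)
  have h2 : HasDerivAt (fun s : ℝ => Φ (z + t * e + ((s - t : ℝ) : ℂ) * e)) (Φ₁ (z + t * e)) t := by
    have := HasDerivAt.comp_sub_const (f := fun s : ℝ => Φ (z + t * e + (s : ℂ) * e))
      (f' := Φ₁ (z + t * e)) t t (by simpa using h1)
    exact this
  refine h2.congr_of_eventuallyEq (Eventually.of_forall fun s => ?_)
  simp only
  congr 1
  push_cast
  ring

namespace HasTwoDerivs

variable {e : ℂ} {Φ Φ₁ Φ₂ Ψ Ψ₁ Ψ₂ : ℂ → ℝ}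

theorem const (e : ℂ) (c : ℝ) : HasTwoDerivs e (fun _ => c) (fun _ => 0) (fun _ => 0) where
  cont := continuous_const
  cont₁ := continuous_const
  cont₂ := continuous_const
  deriv₁ _ := hasDerivAt_const _ _
  deriv₂ _ := hasDerivAt_const _ _

theorem add (h : HasTwoDerivs e Φ Φ₁ Φ₂) (k : HasTwoDerivs e Ψ Ψ₁ Ψ₂) :
    HasTwoDerivs e (fun z => Φ z + Ψ z) (fun z => Φ₁ z + Ψ₁ z) (fun z => Φ₂ z + Ψ₂ z) where
  cont := h.cont.add k.cont
  cont₁ := h.cont₁.add k.cont₁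
  cont₂ := h.cont₂.add k.cont₂
  deriv₁ z := (h.deriv₁ z).add (k.deriv₁ z)
  deriv₂ z := (h.deriv₂ z).add (k.deriv₂ z)

theorem mul (h : HasTwoDerivs e Φ Φ₁ Φ₂) (k : HasTwoDerivs e Ψ Ψ₁ Ψ₂) :
    HasTwoDerivs e (fun z => Φ z * Ψ z) (fun z => Φ₁ z * Ψ z + Φ z * Ψ₁ z)
      (fun z => Φ₂ z * Ψ z + 2 * (Φ₁ z * Ψ₁ z) + Φ z * Ψ₂ z) where
  cont := h.cont.mul k.cont
  cont₁ := (h.cont₁.mul k.cont).add (h.cont.mul k.cont₁)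
  cont₂ := ((h.cont₂.mul k.cont).add (continuous_const.mul (h.cont₁.mul k.cont₁))).add
    (h.cont.mul k.cont₂)
  deriv₁ z := by
    refine ((h.deriv₁ z).mul (k.deriv₁ z)).congr_deriv ?_
    simp
  deriv₂ z := by
    refine (((h.deriv₂ z).mul (k.deriv₁ z)).add ((h.deriv₁ z).mul (k.deriv₂ z))).congr_deriv ?_
    simp only [Complex.ofReal_zero, zero_mul, add_zero]
    ring

theorem const_mul (c : ℝ) (h : HasTwoDerivs e Φ Φ₁ Φ₂) :
    HasTwoDerivs e (fun z => c * Φ z) (fun z => c * Φ₁ z) (fun z => c * Φ₂ z) where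
  cont := continuous_const.mul h.cont
  cont₁ := continuous_const.mul h.cont₁
  cont₂ := continuous_const.mul h.cont₂
  deriv₁ z := (h.deriv₁ z).const_mul c
  deriv₂ z := (h.deriv₂ z).const_mul c

theorem sub (h : HasTwoDerivs e Φ Φ₁ Φ₂) (k : HasTwoDerivs e Ψ Ψ₁ Ψ₂) :
    HasTwoDerivs e (fun z => Φ z - Ψ z) (fun z => Φ₁ z - Ψ₁ z) (fun z => Φ₂ z - Ψ₂ z) where
  cont := h.cont.sub k.cont
  cont₁ := h.cont₁.sub k.cont₁
  cont₂ := h.cont₂.sub k.cont₂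
  deriv₁ z := (h.deriv₁ z).sub (k.deriv₁ z)
  deriv₂ z := (h.deriv₂ z).sub (k.deriv₂ z)

theorem rpow (b : ℝ) (hpos : ∀ z, 0 < Φ z) (h : HasTwoDerivs e Φ Φ₁ Φ₂) :
    HasTwoDerivs e (fun z => Φ z ^ b) (fun z => b * Φ z ^ (b - 1) * Φ₁ z)
      (fun z => b * (b - 1) * Φ z ^ (b - 2) * Φ₁ z ^ 2 + b * Φ z ^ (b - 1) * Φ₂ z) where
  cont := h.cont.rpow_const fun z => Or.inl (hpos z).ne'
  cont₁ := (continuous_const.mul (h.cont.rpow_const fun z => Or.inl (hpos z).ne')).mul h.cont₁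
  cont₂ := ((continuous_const.mul (h.cont.rpow_const fun z => Or.inl (hpos z).ne')).mul
    (h.cont₁.pow 2)).add
      ((continuous_const.mul (h.cont.rpow_const fun z => Or.inl (hpos z).ne')).mul h.cont₂)
  deriv₁ z := by
    have := (h.deriv₁ z).rpow_const (p := b) (Or.inl (hpos _).ne')
    convert this using 1
    simp only [Complex.ofReal_zero, zero_mul, add_zero]
    ring
  deriv₂ z := by
    refine ((((h.deriv₁ z).rpow_const (p := b - 1) (Or.inl (hpos _).ne')).const_mul b).mul
      (h.deriv₂ z)).congr_deriv ?_
    simp only [Complex.ofReal_zero, zero_mul, add_zero]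
    rw [show b - 1 - 1 = b - 2 by ring]
    ring

theorem re {φ φ₁ φ₂ : ℂ → ℂ} (e : ℂ) (h₁ : ∀ z, HasDerivAt φ (φ₁ z) z)
    (h₂ : ∀ z, HasDerivAt φ₁ (φ₂ z) z) (hc : Continuous φ₂) :
    HasTwoDerivs e (fun z => (φ z).re) (fun z => (e * φ₁ z).re) (fun z => (e * (e * φ₂ z)).re) := by
  have c₀ : Continuous φ := continuous_iff_continuousAt.2 fun z => (h₁ z).continuousAt
  have c₁ : Continuous φ₁ := continuous_iff_continuousAt.2 fun z => (h₂ z).continuousAt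
  have key : ∀ (g g' : ℂ → ℂ) (_ : ∀ z, HasDerivAt g (g' z) z) (z : ℂ),
      HasDerivAt (fun s : ℝ => (g (z + s * e)).re) (e * g' z).re 0 := by
    intro g g' hg z
    have hl : HasDerivAt (fun s : ℝ => z + (s : ℂ) * e) e 0 := by
      simpa using ((Complex.ofRealCLM.hasDerivAt (x := (0 : ℝ))).mul_const e).const_add z
    have hg0 : HasDerivAt g (g' z) (z + ((0 : ℝ) : ℂ) * e) := by simpa using hg z
    have := (Complex.reCLM.hasFDerivAt.comp_hasDerivAt (0 : ℝ) (hg0.comp (0 : ℝ) hl))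
    simpa [Function.comp_def, mul_comm] using this
  refine ⟨by fun_prop, by fun_prop, by fun_prop, key φ φ₁ h₁, ?_⟩
  exact key (fun z => e * φ₁ z) (fun z => e * φ₂ z) fun z => (h₂ z).const_mul e

end HasTwoDerivs

/-- Circular means of a periodic subharmonic function bounded above on left half planes increase. -/
theorem integral_vertical_mono {Φ Φx Φy Φxx Φyy : ℂ → ℝ} (hx : HasTwoDerivs 1 Φ Φx Φxx)
    (hy : HasTwoDerivs Complex.I Φ Φy Φyy) (hlap : ∀ z, 0 ≤ Φxx z + Φyy z)
    (hper : ∀ z, Φ (z + 2 * Real.pi * Complex.I) = Φ z)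
    (hbdd : ∀ t : ℝ, ∃ B, ∀ z : ℂ, z.re ≤ t → Φ z ≤ B) :
    Monotone fun t : ℝ => ∫ θ in (0 : ℝ)..(2 * Real.pi), Φ (t + θ * Complex.I) := by
  have hpi := Real.two_pi_pos
  have hD : ∀ (F F' : ℂ → ℝ), Continuous F → Continuous F' →
      (∀ z, HasDerivAt (fun s : ℝ => F (z + s * 1)) (F' z) 0) → ∀ t : ℝ,
      HasDerivAt (fun t : ℝ => ∫ θ in (0 : ℝ)..(2 * Real.pi), F (t + θ * Complex.I))
        (∫ θ in (0 : ℝ)..(2 * Real.pi), F' (t + θ * Complex.I)) t := by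
    intro F F' cF cF' hF t
    have hK : IsCompact ((Icc (t - 1) (t + 1)) ×ˢ (Icc (0 : ℝ) (2 * Real.pi))) :=
      isCompact_Icc.prod isCompact_Icc
    obtain ⟨B, hB⟩ := hK.exists_bound_of_continuousOn
      (f := fun x : ℝ × ℝ => F' (x.1 + x.2 * Complex.I)) (by fun_prop)
    refine (intervalIntegral.hasDerivAt_integral_of_dominated_loc_of_deriv_le (μ := volume)
      (F := fun (t : ℝ) (θ : ℝ) => F (t + θ * Complex.I))
      (F' := fun (t : ℝ) (θ : ℝ) => F' (t + θ * Complex.I)) (bound := fun _ => B)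
      (s := Icc (t - 1) (t + 1)) (Icc_mem_nhds (by linarith) (by linarith)) ?_ ?_ ?_ ?_ ?_ ?_).2
    · exact Eventually.of_forall fun s => (by fun_prop : Continuous _).aestronglyMeasurable
    · exact (by fun_prop : Continuous _).intervalIntegrable _ _
    · exact (by fun_prop : Continuous _).aestronglyMeasurable
    · refine Eventually.of_forall fun θ hθ s hs => hB (s, θ) ⟨hs, ?_⟩
      rw [uIoc_of_le hpi.le] at hθ
      exact Ioc_subset_Icc_self hθ
    · simp
    · refine Eventually.of_forall fun θ _ s _ => ?_
      have := hasDerivAt_line hF (θ * Complex.I) s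
      simpa [add_comm] using this
  set m : ℝ → ℝ := fun t => ∫ θ in (0 : ℝ)..(2 * Real.pi), Φ (t + θ * Complex.I)
  set m₁ : ℝ → ℝ := fun t => ∫ θ in (0 : ℝ)..(2 * Real.pi), Φx (t + θ * Complex.I)
  have hm : ∀ t, HasDerivAt m (m₁ t) t := hD Φ Φx hx.cont hx.cont₁ hx.deriv₁
  have hm₁ := hD Φx Φxx hx.cont₁ hx.cont₂ hx.deriv₂
  have hyper : ∀ z, Φy (z + 2 * Real.pi * Complex.I) = Φy z := by
    intro z
    refine (hy.deriv₁ (z + 2 * Real.pi * Complex.I)).unique ?_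
    refine (hy.deriv₁ z).congr_of_eventuallyEq (Eventually.of_forall fun s => ?_)
    simp only
    rw [← hper (z + s * Complex.I)]
    congr 1
    ring
  have cx := hx.cont₂
  have cy := hy.cont₂
  -- Periodicity in the vertical direction removes the second vertical derivative, so the second
  -- derivative of `m` is the integral of the Laplacian and `m` is convex.
  have hyy : ∀ t : ℝ, ∫ θ in (0 : ℝ)..(2 * Real.pi), Φyy (t + θ * Complex.I) = 0 := by
    intro t
    rw [intervalIntegral.integral_eq_sub_of_hasDerivAt
      (f := fun θ : ℝ => Φy (t + θ * Complex.I))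
      (fun θ _ => hasDerivAt_line hy.deriv₂ t θ)
      ((by fun_prop : Continuous _).intervalIntegrable _ _)]
    have := hyper t
    push_cast
    simp [this]
  have hmono : Monotone m₁ := by
    refine monotone_of_deriv_nonneg (fun t => (hm₁ t).differentiableAt) fun t => ?_
    have hadd := intervalIntegral.integral_add
      ((by fun_prop : Continuous fun θ : ℝ => Φxx (t + θ * Complex.I)).intervalIntegrable
        (μ := volume) 0 (2 * Real.pi))
      ((by fun_prop : Continuous fun θ : ℝ => Φyy (t + θ * Complex.I)).intervalIntegrable
        0 (2 * Real.pi))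
    rw [hyy t, add_zero] at hadd
    rw [(hm₁ t).deriv, ← hadd]
    exact intervalIntegral.integral_nonneg hpi.le fun θ _ => hlap _
  refine monotone_of_deriv_nonneg (fun t => (hm t).differentiableAt) fun t => ?_
  rw [(hm t).deriv]
  -- A convex function with negative slope at `t` tends to infinity to the left of `t`,
  -- contradicting the upper bound on left half planes.
  by_contra! hneg
  obtain ⟨B, hB⟩ := hbdd t
  have hbound : ∀ s ≤ t, m s ≤ 2 * Real.pi * B := by
    intro s hs
    have hc := hx.cont
    have := intervalIntegral.integral_mono_on (μ := volume) hpi.le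
      ((by fun_prop : Continuous fun θ : ℝ => Φ (s + θ * Complex.I)).intervalIntegrable
        0 (2 * Real.pi)) (intervalIntegrable_const (c := B)) fun θ _ => hB _ (by simpa using hs)
    simpa using this
  have hlin : ∀ s ≤ t, m t - m s ≤ m₁ t * (t - s) := by
    intro s hs
    refine (convex_univ (𝕜 := ℝ) (E := ℝ)).inter (convex_Iic t) |>.image_sub_le_mul_sub_of_deriv_le
      (f := m) (C := m₁ t) (fun x _ => (hm x).continuousAt.continuousWithinAt)
      (fun x _ => (hm x).differentiableAt.differentiableWithinAt) ?_ s (by simpa using hs) t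
      (by simp) hs
    intro x hx
    rw [(hm x).deriv]
    exact hmono (by simpa using (interior_subset hx).2)
  -- At distance `L` to the left the tangent line has already reached one more than the bound `2 * π
  -- * B`.
  set L := (2 * Real.pi * B - m t + 1) / (-m₁ t)
  have h0 := hbound t le_rfl
  have hL : 0 ≤ L := div_nonneg (by linarith) (by linarith)
  have h1 := hlin (t - L) (by linarith)
  have h2 := hbound (t - L) (by linarith)
  have h3 : L * (-m₁ t) = 2 * Real.pi * B - m t + 1 := div_mul_cancel₀ _ (by linarith)
  nlinarith

/-- `f ∘ exp` with its first two derivatives. -/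
theorem exists_derivs_comp_exp {f : ℂ → ℂ} (hf : Differentiable ℂ f) :
    ∃ φ₁ φ₂ : ℂ → ℂ, Continuous φ₂ ∧ (∀ z, HasDerivAt (fun z => f (Complex.exp z)) (φ₁ z) z) ∧
      ∀ z, HasDerivAt φ₁ (φ₂ z) z := by
  have h0 : Differentiable ℂ fun z => f (Complex.exp z) := hf.comp Complex.differentiable_exp
  have h1 : Differentiable ℂ (deriv fun z => f (Complex.exp z)) := h0.deriv
  have h2 := h1.deriv
  exact ⟨_, _, h2.continuous, fun z => (h0 z).hasDerivAt, fun z => (h1 z).hasDerivAt⟩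

theorem continuous_circle (r : ℝ) : Continuous fun θ : ℝ => (r * Complex.exp (θ * Complex.I) : ℂ) := by
  fun_prop

/-- Directional derivatives of `|φ|² + ε` for holomorphic `φ`. -/
theorem HasTwoDerivs.normSq {φ φ₁ φ₂ : ℂ → ℂ} (e : ℂ) (ε : ℝ) (h₁ : ∀ z, HasDerivAt φ (φ₁ z) z)
    (h₂ : ∀ z, HasDerivAt φ₁ (φ₂ z) z) (hc : Continuous φ₂) :
    HasTwoDerivs e (fun z => (φ z).re ^ 2 + (φ z).im ^ 2 + ε)
      (fun z => 2 * ((φ z).re * (e * φ₁ z).re + (φ z).im * (e * φ₁ z).im))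
      (fun z => 2 * ((e * φ₁ z).re ^ 2 + (e * φ₁ z).im ^ 2 + (φ z).re * (e * (e * φ₂ z)).re
        + (φ z).im * (e * (e * φ₂ z)).im)) := by
  have hr := HasTwoDerivs.re e h₁ h₂ hc
  -- Im φ is Re(-iφ), so real parts suffice.
  have hi := HasTwoDerivs.re (φ := fun z => -Complex.I * φ z) e
    (fun z => (h₁ z).const_mul _) (fun z => (h₂ z).const_mul _) (by fun_prop)
  have := ((hr.mul hr).add (hi.mul hi)).add (HasTwoDerivs.const e ε)
  convert this using 2 with z z z <;> simp <;> ring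

theorem HasTwoDerivs.reSq {φ φ₁ φ₂ : ℂ → ℂ} (e : ℂ) (ε : ℝ) (h₁ : ∀ z, HasDerivAt φ (φ₁ z) z)
    (h₂ : ∀ z, HasDerivAt φ₁ (φ₂ z) z) (hc : Continuous φ₂) :
    HasTwoDerivs e (fun z => (φ z).re ^ 2 + ε)
      (fun z => 2 * ((φ z).re * (e * φ₁ z).re))
      (fun z => 2 * ((e * φ₁ z).re ^ 2 + (φ z).re * (e * (e * φ₂ z)).re)) := by
  have hr := HasTwoDerivs.re e h₁ h₂ hc
  have := (hr.mul hr).add (HasTwoDerivs.const e ε)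
  convert this using 2 with z z z <;> ring

/-- Circular means of a subharmonic function of an entire function increase with the radius. -/
theorem circle_integral_mono {f : ℂ → ℂ} (hf : Differentiable ℂ f) {G : ℂ → ℝ} (hG : Continuous G)
    {Φx Φy Φxx Φyy : ℂ → ℝ}
    (hx : HasTwoDerivs 1 (fun z => G (f (Complex.exp z))) Φx Φxx)
    (hy : HasTwoDerivs Complex.I (fun z => G (f (Complex.exp z))) Φy Φyy)
    (hlap : ∀ z, 0 ≤ Φxx z + Φyy z) {r s : ℝ} (hr : 0 ≤ r) (hrs : r ≤ s) :
    ∫ θ in (0 : ℝ)..(2 * Real.pi), G (f (r * Complex.exp (θ * Complex.I))) ≤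
      ∫ θ in (0 : ℝ)..(2 * Real.pi), G (f (s * Complex.exp (θ * Complex.I))) := by
  have hfc := hf.continuous
  set m : ℝ → ℝ := fun r =>
    ∫ θ in (0 : ℝ)..(2 * Real.pi), G (f (r * Complex.exp (θ * Complex.I))) with hm
  have hmc : Continuous m := by
    apply intervalIntegral.continuous_parametric_intervalIntegral_of_continuous'
    fun_prop
  have hmono := integral_vertical_mono hx hy hlap
    (fun z => by rw [Complex.exp_periodic z]) (fun t => by
      obtain ⟨B, hB⟩ := (isCompact_closedBall (0 : ℂ) (Real.exp t)).exists_bound_of_continuousOn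
        (hG.comp hfc).continuousOn
      refine ⟨B, fun z hz => (le_abs_self _).trans (hB (Complex.exp z) ?_)⟩
      simpa [Complex.norm_exp] using hz)
  -- In the coordinate w = exp z the circle of radius r is the vertical segment over log r. Radius 0
  -- has no logarithm and is reached by continuity afterwards.
  have hpos : ∀ r s : ℝ, 0 < r → r ≤ s → m r ≤ m s := by
    intro r s hr hrs
    have h := hmono (Real.log_le_log hr hrs)
    simp only [Complex.exp_add, ← Complex.ofReal_exp, Real.exp_log hr,
      Real.exp_log (hr.trans_le hrs)] at h
    exact h
  rcases hr.eq_or_lt with rfl | hr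
  · rcases hrs.eq_or_lt with rfl | hs
    · rfl
    · refine le_of_tendsto (hmc.tendsto 0 |>.mono_left (nhdsWithin_le_nhds (s := Ioi 0))) ?_
      filter_upwards [Ioo_mem_nhdsGT hs] with x hx
      exact hpos x s hx.1 hx.2.le
  · exact hpos r s hr hrs

/-- The left side is the Laplacian of w^b when |∇w|² = 4ND and Δw = 4D. For w = |φ|² + ε with φ
holomorphic this holds with N = |φ|² and D = |φ'|². -/
theorem laplacian_rpow_normSq {b w N D : ℝ} (hw : 0 < w) :
    b * (b - 1) * w ^ (b - 2) * (4 * N * D) + b * w ^ (b - 1) * (4 * D)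
      = 4 * b * D * w ^ (b - 2) * (w + (b - 1) * N) := by
  rw [show b - 1 = (b - 2) + 1 by ring, Real.rpow_add_one hw.ne']
  ring

/-- The regularization by ε keeps the power smooth at the zeros of f. -/
theorem circle_integral_regularized_mono {f : ℂ → ℂ} (hf : Differentiable ℂ f) {b ε : ℝ}
    (hb : 0 < b) (hε : 0 < ε) {r s : ℝ} (hr : 0 ≤ r) (hrs : r ≤ s) :
    ∫ θ in (0 : ℝ)..(2 * Real.pi), ((f (r * Complex.exp (θ * Complex.I))).re ^ 2
        + (f (r * Complex.exp (θ * Complex.I))).im ^ 2 + ε) ^ b ≤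
      ∫ θ in (0 : ℝ)..(2 * Real.pi), ((f (s * Complex.exp (θ * Complex.I))).re ^ 2
        + (f (s * Complex.exp (θ * Complex.I))).im ^ 2 + ε) ^ b := by
  obtain ⟨φ₁, φ₂, hc, h₁, h₂⟩ := exists_derivs_comp_exp hf
  have hpos : ∀ z : ℂ, 0 < z.re ^ 2 + z.im ^ 2 + ε := fun z => by positivity
  have hw := fun e => HasTwoDerivs.normSq e ε h₁ h₂ hc
  have hΦ := fun e => (hw e).rpow b fun z => hpos _
  refine circle_integral_mono hf (G := fun z => (z.re ^ 2 + z.im ^ 2 + ε) ^ b) ?_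
    (hΦ 1) (hΦ Complex.I) ?_ hr hrs
  · exact (by fun_prop : Continuous fun z : ℂ => z.re ^ 2 + z.im ^ 2 + ε).rpow_const
      fun z => Or.inl (hpos z).ne'
  · intro z
    have key := laplacian_rpow_normSq (b := b) (N := (f (Complex.exp z)).re ^ 2
      + (f (Complex.exp z)).im ^ 2) (D := (φ₁ z).re ^ 2 + (φ₁ z).im ^ 2) (hpos (f (Complex.exp z)))
    have hnn : 0 ≤ 4 * b * ((φ₁ z).re ^ 2 + (φ₁ z).im ^ 2) *
        ((f (Complex.exp z)).re ^ 2 + (f (Complex.exp z)).im ^ 2 + ε) ^ (b - 2) *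
        ((f (Complex.exp z)).re ^ 2 + (f (Complex.exp z)).im ^ 2 + ε
          + (b - 1) * ((f (Complex.exp z)).re ^ 2 + (f (Complex.exp z)).im ^ 2)) := by
      have := (hpos (f (Complex.exp z))).le
      refine mul_nonneg (by positivity) ?_
      -- The last factor of the Laplacian equals bN + ε with N = |f|², which is positive even for b
      -- < 1.
      have : 0 ≤ b * ((f (Complex.exp z)).re ^ 2 + (f (Complex.exp z)).im ^ 2) := by positivity
      linarith
    rw [← key] at hnn
    refine hnn.trans_eq ?_
    simp
    ring

/-! ### M. Riesz's inequality by comparison of Laplacians. -/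

theorem norm_rpow_eq (z : ℂ) (q : ℝ) : ‖z‖ ^ q = (z.re ^ 2 + z.im ^ 2) ^ (q / 2) := by
  have h : z.re ^ 2 + z.im ^ 2 = ‖z‖ ^ (2 : ℝ) := by
    rw [Real.rpow_two, ← Complex.normSq_eq_norm_sq, Complex.normSq_apply]; ring
  rw [h, ← Real.rpow_mul (norm_nonneg _)]
  congr 1; ring

theorem abs_rpow_eq (x q : ℝ) : |x| ^ q = (x ^ 2) ^ (q / 2) := by
  rw [← sq_abs, ← Real.rpow_two, ← Real.rpow_mul (abs_nonneg _)]
  congr 1; ring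

theorem le_of_forall_pos_le_add_rpow {x y c b : ℝ} (hb : 0 < b)
    (h : ∀ ε : ℝ, 0 < ε → x ≤ y + c * ε ^ b) : x ≤ y := by
  have ht : Tendsto (fun ε : ℝ => y + c * ε ^ b) (𝓝[>] 0) (𝓝 (y + c * 0 ^ b)) :=
    ((continuous_const.add (continuous_const.mul
      (Real.continuous_rpow_const hb.le))).tendsto 0).mono_left nhdsWithin_le_nhds
  rw [Real.zero_rpow hb.ne', mul_zero, add_zero] at ht
  exact ge_of_tendsto ht (eventually_mem_nhdsWithin.mono fun ε hε => h ε hε)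

/-- With u = Re f, the Laplacian of (|f|² + ε)^{q/2} is at most 2/(q-1) times that of (u² +
ε)^{q/2}; since q ≤ 2, the exponent q/2 - 1 is nonpositive and passing from |f|² to u² only
increases the power. The scaled difference is therefore subharmonic, and f(0) = 0 makes it
nonnegative at the origin. -/
theorem circle_integral_re_of_le_two {q : ℝ} (hq : 1 < q) (hq2 : q ≤ 2) {f : ℂ → ℂ}
    (hf : Differentiable ℂ f) (hf0 : f 0 = 0) {s : ℝ} (hs : 0 ≤ s) :
    ∫ θ in (0 : ℝ)..(2 * Real.pi), ‖f (s * Complex.exp (θ * Complex.I))‖ ^ q ≤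
      2 / (q - 1) * ∫ θ in (0 : ℝ)..(2 * Real.pi),
        |(f (s * Complex.exp (θ * Complex.I))).re| ^ q := by
  obtain ⟨φ₁, φ₂, hc, h₁, h₂⟩ := exists_derivs_comp_exp hf
  have hfc := hf.continuous
  have hpi := Real.two_pi_pos
  set b := q / 2 with hbdef
  set A := 2 / (q - 1) with hA
  have hApos : 1 ≤ A := by rw [hA, le_div_iff₀ (by linarith)]; linarith
  have hb : 0 < b := by positivity
  refine le_of_forall_pos_le_add_rpow (c := A * (2 * Real.pi)) hb fun ε hε => ?_
  have hpos : ∀ z : ℂ, 0 < z.re ^ 2 + z.im ^ 2 + ε := fun z => by positivity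
  have hpos' : ∀ z : ℂ, 0 < z.re ^ 2 + ε := fun z => by positivity
  have hw := fun e => HasTwoDerivs.normSq e ε h₁ h₂ hc
  have hu := fun e => HasTwoDerivs.reSq e ε h₁ h₂ hc
  have hΦ := fun e => (((hu e).rpow b fun z => hpos' _).const_mul A).sub
    ((hw e).rpow b fun z => hpos _)
  have cw : Continuous fun z : ℂ => (z.re ^ 2 + z.im ^ 2 + ε) ^ b :=
    (by fun_prop : Continuous fun z : ℂ => z.re ^ 2 + z.im ^ 2 + ε).rpow_const
      fun z => Or.inl (hpos z).ne'
  have cu : Continuous fun z : ℂ => (z.re ^ 2 + ε) ^ b :=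
    (by fun_prop : Continuous fun z : ℂ => z.re ^ 2 + ε).rpow_const
      fun z => Or.inl (hpos' z).ne'
  have key := circle_integral_mono hf
    (G := fun z => A * (z.re ^ 2 + ε) ^ b - (z.re ^ 2 + z.im ^ 2 + ε) ^ b) (by fun_prop)
    (hΦ 1) (hΦ Complex.I) ?_ le_rfl hs
  · have i1 : IntervalIntegrable (fun θ : ℝ => A *
        ((f (s * Complex.exp (θ * Complex.I))).re ^ 2 + ε) ^ b) volume 0 (2 * Real.pi) :=
      (continuous_const.mul (cu.comp (hfc.comp (continuous_circle s)))).intervalIntegrable _ _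
    have i2 : IntervalIntegrable (fun θ : ℝ => ((f (s * Complex.exp (θ * Complex.I))).re ^ 2 +
        (f (s * Complex.exp (θ * Complex.I))).im ^ 2 + ε) ^ b) volume 0 (2 * Real.pi) :=
      (cw.comp (hfc.comp (continuous_circle s))).intervalIntegrable _ _
    rw [intervalIntegral.integral_sub i1 i2] at key
    -- At radius 0 the integrand is (A - 1)ε^b, nonnegative because A ≥ 1.
    have h0 : 0 ≤ ∫ θ in (0 : ℝ)..(2 * Real.pi),
        (A * ((f (((0 : ℝ) : ℂ) * Complex.exp (θ * Complex.I))).re ^ 2 + ε) ^ b -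
        ((f (((0 : ℝ) : ℂ) * Complex.exp (θ * Complex.I))).re ^ 2 +
          (f (((0 : ℝ) : ℂ) * Complex.exp (θ * Complex.I))).im ^ 2 + ε) ^ b) := by
      simp only [Complex.ofReal_zero, zero_mul, hf0, Complex.zero_re, Complex.zero_im]
      refine intervalIntegral.integral_nonneg hpi.le fun θ _ => ?_
      have : 0 ≤ ε ^ b := by positivity
      norm_num
      nlinarith
    have j1 : IntervalIntegrable (fun θ : ℝ => ‖f (s * Complex.exp (θ * Complex.I))‖ ^ q)
        volume 0 (2 * Real.pi) :=
      ((continuous_norm.comp (hfc.comp (continuous_circle s))).rpow_const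
        fun _ => Or.inr (by linarith)).intervalIntegrable _ _
    have j2 : IntervalIntegrable (fun θ : ℝ => |(f (s * Complex.exp (θ * Complex.I))).re| ^ q)
        volume 0 (2 * Real.pi) :=
      ((continuous_abs.comp (Complex.continuous_re.comp (hfc.comp (continuous_circle s)))).rpow_const
        fun _ => Or.inr (by linarith)).intervalIntegrable _ _
    calc _ ≤ ∫ θ in (0 : ℝ)..(2 * Real.pi), ((f (s * Complex.exp (θ * Complex.I))).re ^ 2 +
          (f (s * Complex.exp (θ * Complex.I))).im ^ 2 + ε) ^ b := by
          refine intervalIntegral.integral_mono_on hpi.le j1 i2 fun θ _ => ?_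
          rw [norm_rpow_eq]
          exact Real.rpow_le_rpow (by positivity) (by linarith) hb.le
      _ ≤ ∫ θ in (0 : ℝ)..(2 * Real.pi), A *
          ((f (s * Complex.exp (θ * Complex.I))).re ^ 2 + ε) ^ b := by linarith
      _ ≤ ∫ θ in (0 : ℝ)..(2 * Real.pi),
          A * (|(f (s * Complex.exp (θ * Complex.I))).re| ^ q + ε ^ b) := by
          refine intervalIntegral.integral_mono_on hpi.le i1
            ((j2.add intervalIntegrable_const).const_mul _) fun θ _ => ?_
          rw [abs_rpow_eq]
          gcongr
          exact Real.rpow_add_le_add_rpow (by positivity) hε.le hb.le (by linarith)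
      _ = _ := by
          rw [intervalIntegral.integral_const_mul, intervalIntegral.integral_add j2
            intervalIntegrable_const, intervalIntegral.integral_const]
          simp only [smul_eq_mul, sub_zero]
          ring
  · intro z
    have hN := hpos (f (Complex.exp z))
    have hU := hpos' (f (Complex.exp z))
    set u := (f (Complex.exp z)).re
    set v := (f (Complex.exp z)).im
    set D := (φ₁ z).re ^ 2 + (φ₁ z).im ^ 2 with hD
    have hD0 : 0 ≤ D := by positivity
    have kw := laplacian_rpow_normSq (b := b) (N := u ^ 2 + v ^ 2) (D := D) hN
    -- For u² + ε one has |∇(u²)|² = 4u²D and Δ(u²) = 2D, which is the pattern of the lemma with N =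
    -- 2u² and D/2 in place of D.
    have ku := laplacian_rpow_normSq (b := b) (N := 2 * u ^ 2) (D := D / 2) hU
    have ew : (u ^ 2 + v ^ 2 + ε) ^ (b - 1) = (u ^ 2 + v ^ 2 + ε) ^ (b - 2) * (u ^ 2 + v ^ 2 + ε) := by
      rw [← Real.rpow_add_one hN.ne']; congr 1; ring
    have eu : (u ^ 2 + ε) ^ (b - 1) = (u ^ 2 + ε) ^ (b - 2) * (u ^ 2 + ε) := by
      rw [← Real.rpow_add_one hU.ne']; congr 1; ring
    have h1 : (u ^ 2 + v ^ 2 + ε) ^ (b - 1) ≤ (u ^ 2 + ε) ^ (b - 1) :=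
      Real.rpow_le_rpow_of_nonpos hU (by nlinarith [sq_nonneg v]) (by linarith)
    have h2 : 4 * b * D * (u ^ 2 + v ^ 2 + ε) ^ (b - 2) *
        (u ^ 2 + v ^ 2 + ε + (b - 1) * (u ^ 2 + v ^ 2)) ≤ 4 * b * D * (u ^ 2 + v ^ 2 + ε) ^ (b - 1) := by
      rw [ew, ← mul_assoc]
      refine mul_le_mul_of_nonneg_left ?_ (by positivity)
      nlinarith [sq_nonneg u, sq_nonneg v]
    -- Since 2(b - 1) = q - 2, the bracket is (q - 1)u² + ε, at least (q - 1)(u² + ε) because q - 1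
    -- ≤ 1.
    have h3 : 2 * b * (q - 1) * D * (u ^ 2 + ε) ^ (b - 1) ≤ 4 * b * (D / 2) * (u ^ 2 + ε) ^ (b - 2) *
        (u ^ 2 + ε + (b - 1) * (2 * u ^ 2)) := by
      have : 2 * b * (q - 1) * D * (u ^ 2 + ε) ^ (b - 1) =
          4 * b * (D / 2) * (u ^ 2 + ε) ^ (b - 2) * ((q - 1) * (u ^ 2 + ε)) := by rw [eu]; ring
      rw [this]
      refine mul_le_mul_of_nonneg_left ?_ (by positivity)
      nlinarith [sq_nonneg u]
    have h4 : 4 * b * D * (u ^ 2 + ε) ^ (b - 1) ≤ A * (4 * b * (D / 2) * (u ^ 2 + ε) ^ (b - 2) *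
        (u ^ 2 + ε + (b - 1) * (2 * u ^ 2))) := by
      refine le_trans (le_of_eq ?_) (mul_le_mul_of_nonneg_left h3 (by linarith))
      rw [hA]
      have : q - 1 ≠ 0 := by linarith
      field_simp
      ring
    have h5 : 4 * b * D * (u ^ 2 + v ^ 2 + ε) ^ (b - 1) ≤ 4 * b * D * (u ^ 2 + ε) ^ (b - 1) :=
      mul_le_mul_of_nonneg_left h1 (by positivity)
    have h6 := h2.trans (h5.trans h4)
    rw [← kw, ← ku, ← sub_nonneg] at h6
    refine h6.trans_eq ?_
    simp
    ring

/-- Here q = 2(a+1). With w = |f|² + ε, the Laplacian of u²w^a is at least 2Dw^a, its other terms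
being nonnegative, while that of w^{a+1} is at most 4(a+1)²Dw^a. So B u²w^a - w^{a+1} is subharmonic
for B = 2(a+1)², and Young's inequality then lets half of the integral of w^{a+1} be absorbed on the
left. -/
theorem circle_integral_re_of_two_le {a : ℝ} (ha : 0 ≤ a) {f : ℂ → ℂ}
    (hf : Differentiable ℂ f) (hf0 : f 0 = 0) {s : ℝ} (hs : 0 ≤ s) :
    ∫ θ in (0 : ℝ)..(2 * Real.pi), ‖f (s * Complex.exp (θ * Complex.I))‖ ^ (2 * (a + 1)) ≤
      (4 * (a + 1) ^ 2) ^ (a + 1) * ∫ θ in (0 : ℝ)..(2 * Real.pi),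
        |(f (s * Complex.exp (θ * Complex.I))).re| ^ (2 * (a + 1)) := by
  obtain ⟨φ₁, φ₂, hc, h₁, h₂⟩ := exists_derivs_comp_exp hf
  have hfc := hf.continuous
  have hpi := Real.two_pi_pos
  set B := 2 * (a + 1) ^ 2 with hB
  have hBpos : 0 < B := by positivity
  refine le_of_forall_pos_le_add_rpow (c := 4 * Real.pi) (b := a + 1) (by linarith) fun ε hε => ?_
  have hpos : ∀ z : ℂ, 0 < z.re ^ 2 + z.im ^ 2 + ε := fun z => by positivity
  have hw := fun e => HasTwoDerivs.normSq e ε h₁ h₂ hc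
  have hu := fun e => HasTwoDerivs.reSq e 0 h₁ h₂ hc
  have hΦ := fun e => (((hu e).mul ((hw e).rpow a fun z => hpos _)).const_mul B).sub
    ((hw e).rpow (a + 1) fun z => hpos _)
  have cw : ∀ b : ℝ, Continuous fun z : ℂ => (z.re ^ 2 + z.im ^ 2 + ε) ^ b := fun b =>
    (by fun_prop : Continuous fun z : ℂ => z.re ^ 2 + z.im ^ 2 + ε).rpow_const
      fun z => Or.inl (hpos z).ne'
  have cwa := cw a
  have cwb := cw (a + 1)
  have key := circle_integral_mono hf
    (G := fun z => B * ((z.re ^ 2 + 0) * (z.re ^ 2 + z.im ^ 2 + ε) ^ a) -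
      (z.re ^ 2 + z.im ^ 2 + ε) ^ (a + 1)) (by fun_prop)
    (hΦ 1) (hΦ Complex.I) ?_ le_rfl hs
  · have i1 : IntervalIntegrable (fun θ : ℝ => B *
        (((f (s * Complex.exp (θ * Complex.I))).re ^ 2 + 0) *
          ((f (s * Complex.exp (θ * Complex.I))).re ^ 2 +
          (f (s * Complex.exp (θ * Complex.I))).im ^ 2 + ε) ^ a)) volume 0 (2 * Real.pi) :=
      ((by fun_prop : Continuous fun z : ℂ => B * ((z.re ^ 2 + 0) *
        (z.re ^ 2 + z.im ^ 2 + ε) ^ a)).comp (hfc.comp (continuous_circle s))).intervalIntegrable _ _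
    have i2 : IntervalIntegrable (fun θ : ℝ => ((f (s * Complex.exp (θ * Complex.I))).re ^ 2 +
        (f (s * Complex.exp (θ * Complex.I))).im ^ 2 + ε) ^ (a + 1)) volume 0 (2 * Real.pi) :=
      (cwb.comp (hfc.comp (continuous_circle s))).intervalIntegrable _ _
    rw [intervalIntegral.integral_sub i1 i2] at key
    -- The value at the origin is now slightly negative; doubled by the absorption, it becomes the
    -- error term 4π ε^{a+1}.
    have h0 : - (2 * Real.pi * ε ^ (a + 1)) = ∫ θ in (0 : ℝ)..(2 * Real.pi),
        (B * (((f (((0 : ℝ) : ℂ) * Complex.exp (θ * Complex.I))).re ^ 2 + 0) *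
        ((f (((0 : ℝ) : ℂ) * Complex.exp (θ * Complex.I))).re ^ 2 +
          (f (((0 : ℝ) : ℂ) * Complex.exp (θ * Complex.I))).im ^ 2 + ε) ^ a) -
        ((f (((0 : ℝ) : ℂ) * Complex.exp (θ * Complex.I))).re ^ 2 +
          (f (((0 : ℝ) : ℂ) * Complex.exp (θ * Complex.I))).im ^ 2 + ε) ^ (a + 1)) := by
      simp [hf0]
    have j1 : IntervalIntegrable (fun θ : ℝ => ‖f (s * Complex.exp (θ * Complex.I))‖ ^ (2 * (a + 1)))
        volume 0 (2 * Real.pi) :=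
      ((continuous_norm.comp (hfc.comp (continuous_circle s))).rpow_const
        fun _ => Or.inr (by linarith)).intervalIntegrable _ _
    have j2 : IntervalIntegrable (fun θ : ℝ => |(f (s * Complex.exp (θ * Complex.I))).re| ^
        (2 * (a + 1))) volume 0 (2 * Real.pi) :=
      ((continuous_abs.comp (Complex.continuous_re.comp (hfc.comp (continuous_circle s)))).rpow_const
        fun _ => Or.inr (by linarith)).intervalIntegrable _ _
    have e1 : ∫ θ in (0 : ℝ)..(2 * Real.pi), ‖f (s * Complex.exp (θ * Complex.I))‖ ^ (2 * (a + 1)) ≤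
        ∫ θ in (0 : ℝ)..(2 * Real.pi), ((f (s * Complex.exp (θ * Complex.I))).re ^ 2 +
          (f (s * Complex.exp (θ * Complex.I))).im ^ 2 + ε) ^ (a + 1) := by
      refine intervalIntegral.integral_mono_on hpi.le j1 i2 fun θ _ => ?_
      rw [norm_rpow_eq, show 2 * (a + 1) / 2 = a + 1 by ring]
      exact Real.rpow_le_rpow (by positivity) (by linarith) (by linarith)
    have young : ∀ z : ℂ, B * ((z.re ^ 2 + 0) * (z.re ^ 2 + z.im ^ 2 + ε) ^ a) ≤
        1 / 2 * (z.re ^ 2 + z.im ^ 2 + ε) ^ (a + 1) +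
          1 / 2 * (4 * (a + 1) ^ 2) ^ (a + 1) * |z.re| ^ (2 * (a + 1)) := by
      intro z
      have hw0 := hpos z
      rw [abs_rpow_eq, show 2 * (a + 1) / 2 = a + 1 by ring, add_zero,
        show 4 * (a + 1) ^ 2 = 2 * B by rw [hB]; ring]
      generalize z.re ^ 2 + z.im ^ 2 + ε = w at hw0
      have hx : 0 ≤ z.re ^ 2 := sq_nonneg _
      generalize z.re ^ 2 = x at hx
      rw [mul_assoc (1 / 2 : ℝ) ((2 * B) ^ (a + 1)), ← Real.mul_rpow (by positivity) hx, Real.rpow_add_one hw0.ne',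
        Real.rpow_add_one' (by positivity) (by linarith)]
      have hwa : 0 ≤ w ^ a := by positivity
      have hxa : 0 ≤ (2 * B * x) ^ a := by positivity
      -- B x w^a is half of (2Bx)w^a, which is at most the larger of w^{a+1} and (2Bx)^{a+1}.
      rcases le_total (2 * B * x) w with h | h
      · have : 0 ≤ (2 * B * x) ^ a * (2 * B * x) := by positivity
        nlinarith
      · have h2 : w ^ a ≤ (2 * B * x) ^ a := Real.rpow_le_rpow hw0.le h ha
        have : 0 ≤ w ^ a * w := by positivity
        nlinarith [mul_le_mul_of_nonneg_right h2 (by positivity : 0 ≤ 2 * B * x)]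
    have e2 : ∫ θ in (0 : ℝ)..(2 * Real.pi), B *
        (((f (s * Complex.exp (θ * Complex.I))).re ^ 2 + 0) *
          ((f (s * Complex.exp (θ * Complex.I))).re ^ 2 +
          (f (s * Complex.exp (θ * Complex.I))).im ^ 2 + ε) ^ a) ≤
        ∫ θ in (0 : ℝ)..(2 * Real.pi), (1 / 2 * ((f (s * Complex.exp (θ * Complex.I))).re ^ 2 +
          (f (s * Complex.exp (θ * Complex.I))).im ^ 2 + ε) ^ (a + 1) +
          1 / 2 * (4 * (a + 1) ^ 2) ^ (a + 1) *
            |(f (s * Complex.exp (θ * Complex.I))).re| ^ (2 * (a + 1))) :=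
      intervalIntegral.integral_mono_on hpi.le i1
        ((i2.const_mul _).add (j2.const_mul _)) fun θ _ => young _
    rw [intervalIntegral.integral_add (i2.const_mul _) (j2.const_mul _)] at e2
    simp only [intervalIntegral.integral_const_mul] at e2 key
    linarith
  · intro z
    have hN := hpos (f (Complex.exp z))
    set u := (f (Complex.exp z)).re
    set v := (f (Complex.exp z)).im
    set D := (φ₁ z).re ^ 2 + (φ₁ z).im ^ 2 with hD
    have hD0 : 0 ≤ D := by positivity
    have hw0 := hN
    have hwv : u ^ 2 + v ^ 2 ≤ u ^ 2 + v ^ 2 + ε := by linarith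
    have k0 := laplacian_rpow_normSq (b := a) (N := u ^ 2 + v ^ 2) (D := D) hN
    have k1 := laplacian_rpow_normSq (b := a + 1) (N := u ^ 2 + v ^ 2) (D := D) hN
    have ew : (u ^ 2 + v ^ 2 + ε) ^ a = (u ^ 2 + v ^ 2 + ε) ^ (a - 1) * (u ^ 2 + v ^ 2 + ε) := by
      rw [← Real.rpow_add_one hN.ne']; congr 1; ring
    have h1 : 4 * (a + 1) * D * (u ^ 2 + v ^ 2 + ε) ^ (a + 1 - 2) *
        (u ^ 2 + v ^ 2 + ε + (a + 1 - 1) * (u ^ 2 + v ^ 2)) ≤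
        B * (2 * D * (u ^ 2 + v ^ 2 + ε) ^ a) := by
      rw [ew, hB, show a + 1 - 2 = a - 1 by ring]
      have : 2 * (a + 1) ^ 2 * (2 * D * ((u ^ 2 + v ^ 2 + ε) ^ (a - 1) * (u ^ 2 + v ^ 2 + ε))) =
        4 * (a + 1) * D * (u ^ 2 + v ^ 2 + ε) ^ (a - 1) * ((a + 1) * (u ^ 2 + v ^ 2 + ε)) := by ring
      rw [this]
      refine mul_le_mul_of_nonneg_left ?_ (by positivity)
      nlinarith
    have h2 : 0 ≤ u ^ 2 * (4 * a * D * (u ^ 2 + v ^ 2 + ε) ^ (a - 2) *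
        (u ^ 2 + v ^ 2 + ε + (a - 1) * (u ^ 2 + v ^ 2))) := by
      refine mul_nonneg (sq_nonneg _) (mul_nonneg (by positivity) ?_)
      nlinarith [mul_nonneg ha (by positivity : 0 ≤ u ^ 2 + v ^ 2)]
    have h3 : 0 ≤ 8 * (u ^ 2 * (a * (u ^ 2 + v ^ 2 + ε) ^ (a - 1) * D)) := by positivity
    have h4 : 0 ≤ B * (2 * D * (u ^ 2 + v ^ 2 + ε) ^ a + 8 * (u ^ 2 * (a * (u ^ 2 + v ^ 2 + ε) ^ (a - 1) * D)) +
        u ^ 2 * (4 * a * D * (u ^ 2 + v ^ 2 + ε) ^ (a - 2) *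
        (u ^ 2 + v ^ 2 + ε + (a - 1) * (u ^ 2 + v ^ 2)))) - 4 * (a + 1) * D * (u ^ 2 + v ^ 2 + ε) ^ (a + 1 - 2) *
        (u ^ 2 + v ^ 2 + ε + (a + 1 - 1) * (u ^ 2 + v ^ 2)) := by
      have h5 := mul_nonneg hBpos.le (add_nonneg h3 h2)
      linarith
    rw [← k0, ← k1] at h4
    refine h4.trans_eq ?_
    simp
    ring

/-- M. Riesz: an entire function vanishing at the origin is controlled by its real part. -/
theorem exists_circle_integral_le_re {q : ℝ} (hq : 1 < q) : ∃ C : ℝ, 0 < C ∧ ∀ f : ℂ → ℂ,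
    Differentiable ℂ f → f 0 = 0 → ∀ s : ℝ, 0 ≤ s →
    ∫ θ in (0 : ℝ)..(2 * Real.pi), ‖f (s * Complex.exp (θ * Complex.I))‖ ^ q ≤
      C * ∫ θ in (0 : ℝ)..(2 * Real.pi), |(f (s * Complex.exp (θ * Complex.I))).re| ^ q := by
  rcases le_total q 2 with h | h
  · exact ⟨2 / (q - 1), div_pos two_pos (by linarith), fun f hf hf0 s hs =>
      circle_integral_re_of_le_two hq h hf hf0 hs⟩
  · have ha : 0 ≤ q / 2 - 1 := by linarith
    refine ⟨(4 * (q / 2 - 1 + 1) ^ 2) ^ (q / 2 - 1 + 1), by positivity, fun f hf hf0 s hs => ?_⟩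
    have := circle_integral_re_of_two_le ha hf hf0 hs
    rwa [show 2 * (q / 2 - 1 + 1) = q by ring] at this

/-! ### L^q norms on circles and the Riesz projection. -/

/-- Normalized Lebesgue measure on `(0, 2π]`. -/
noncomputable def circleMeasure : Measure ℝ :=
  ENNReal.ofReal (1 / (2 * Real.pi)) • volume.restrict (Ioc 0 (2 * Real.pi))

instance : IsProbabilityMeasure circleMeasure where
  measure_univ := by
    rw [circleMeasure, Measure.smul_apply, Measure.restrict_apply_univ, Real.volume_Ioc,
      smul_eq_mul, ← ENNReal.ofReal_mul (by positivity), sub_zero,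
      one_div_mul_cancel Real.two_pi_pos.ne', ENNReal.ofReal_one]

theorem lintegral_circleMeasure {h : ℝ → ℝ} (hc : Continuous h) (h0 : ∀ θ, 0 ≤ h θ) :
    ∫⁻ θ, ENNReal.ofReal (h θ) ∂circleMeasure =
      ENNReal.ofReal (1 / (2 * Real.pi) * ∫ θ in (0 : ℝ)..(2 * Real.pi), h θ) := by
  rw [circleMeasure, lintegral_smul_measure, smul_eq_mul, ENNReal.ofReal_mul (by positivity),
    intervalIntegral.integral_of_le Real.two_pi_pos.le,
    ofReal_integral_eq_lintegral_ofReal (hc.integrableOn_Ioc) (Eventually.of_forall h0)]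

theorem eLpNorm_circleMeasure {E : Type*} [NormedAddCommGroup E] {q : ℝ} (hq : 0 < q) {h : ℝ → E}
    (hc : Continuous h) :
    eLpNorm h (ENNReal.ofReal q) circleMeasure = ENNReal.ofReal
      ((1 / (2 * Real.pi) * ∫ θ in (0 : ℝ)..(2 * Real.pi), ‖h θ‖ ^ q) ^ (1 / q)) := by
  have hpos : 0 ≤ ∫ θ in (0 : ℝ)..(2 * Real.pi), ‖h θ‖ ^ q :=
    intervalIntegral.integral_nonneg Real.two_pi_pos.le fun θ _ => by positivity
  rw [eLpNorm_eq_lintegral_rpow_enorm_toReal (by simpa using hq) ENNReal.ofReal_ne_top,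
    ENNReal.toReal_ofReal hq.le, ← ENNReal.ofReal_rpow_of_nonneg (by positivity) (by positivity),
    ← lintegral_circleMeasure (hc.norm.rpow_const fun _ => Or.inr hq.le) fun θ => by positivity]
  congr 1
  refine lintegral_congr fun θ => ?_
  rw [← ENNReal.ofReal_rpow_of_nonneg (norm_nonneg _) hq.le, ofReal_norm]

theorem eLpNorm_circleMeasure_le {E F : Type*} [NormedAddCommGroup E] [NormedAddCommGroup F] {q : ℝ}
    (hq : 0 < q) {h : ℝ → E} {k : ℝ → F} (hc : Continuous h) (kc : Continuous k) {C : ℝ} (hC : 0 ≤ C)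
    (hle : ∫ θ in (0 : ℝ)..(2 * Real.pi), ‖h θ‖ ^ q ≤ C * ∫ θ in (0 : ℝ)..(2 * Real.pi), ‖k θ‖ ^ q) :
    eLpNorm h (ENNReal.ofReal q) circleMeasure ≤
      ENNReal.ofReal (C ^ (1 / q)) * eLpNorm k (ENNReal.ofReal q) circleMeasure := by
  have hpos : 0 ≤ ∫ θ in (0 : ℝ)..(2 * Real.pi), ‖h θ‖ ^ q :=
    intervalIntegral.integral_nonneg Real.two_pi_pos.le fun θ _ => by positivity
  have kpos : 0 ≤ ∫ θ in (0 : ℝ)..(2 * Real.pi), ‖k θ‖ ^ q :=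
    intervalIntegral.integral_nonneg Real.two_pi_pos.le fun θ _ => by positivity
  rw [eLpNorm_circleMeasure hq hc, eLpNorm_circleMeasure hq kc,
    ← ENNReal.ofReal_mul (by positivity), ← Real.mul_rpow hC (by positivity)]
  refine ENNReal.ofReal_le_ofReal (Real.rpow_le_rpow (by positivity) ?_ (by positivity))
  calc _ ≤ 1 / (2 * Real.pi) * (C * ∫ θ in (0 : ℝ)..(2 * Real.pi), ‖k θ‖ ^ q) := by gcongr
    _ = _ := by ring

/-- The `L^q` norm on the circle of radius `r`. -/
noncomputable def circleNorm (q r : ℝ) (f : ℂ → ℂ) : ℝ≥0∞ :=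
  eLpNorm (fun θ : ℝ => f (r * Complex.exp (θ * Complex.I))) (ENNReal.ofReal q) circleMeasure

theorem ofReal_integralMean {q r : ℝ} (hq : 0 < q) {f : ℂ → ℂ}
    (hc : Continuous fun θ : ℝ => f (r * Complex.exp (θ * Complex.I))) :
    ENNReal.ofReal (MixedNorm.integralMean q r f) = circleNorm q r f :=
  (eLpNorm_circleMeasure hq hc).symm

theorem circleNorm_mono_radius {q : ℝ} (hq : 0 < q) {f : ℂ → ℂ} (hf : Differentiable ℂ f) {r s : ℝ}
    (hr : 0 ≤ r) (hrs : r ≤ s) : circleNorm q r f ≤ circleNorm q s f := by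
  have hfc := hf.continuous
  have hle : ∫ θ in (0 : ℝ)..(2 * Real.pi), ‖f (r * Complex.exp (θ * Complex.I))‖ ^ q ≤
      ∫ θ in (0 : ℝ)..(2 * Real.pi), ‖f (s * Complex.exp (θ * Complex.I))‖ ^ q := by
    set J : ℝ → ℝ → ℝ := fun r ε => ∫ θ in (0 : ℝ)..(2 * Real.pi),
      ((f (r * Complex.exp (θ * Complex.I))).re ^ 2
        + (f (r * Complex.exp (θ * Complex.I))).im ^ 2 + ε) ^ (q / 2) with hJ
    have hJc : ∀ r, Continuous (J r) := by
      intro r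
      apply intervalIntegral.continuous_parametric_intervalIntegral_of_continuous'
      exact Continuous.rpow_const (by fun_prop) fun _ => Or.inr (by positivity)
    have h0 : ∀ r : ℝ, ∫ θ in (0 : ℝ)..(2 * Real.pi),
        ‖f (r * Complex.exp (θ * Complex.I))‖ ^ q = J r 0 := by
      intro r
      simp only [hJ, norm_rpow_eq, add_zero]
    rw [h0, h0]
    refine le_of_tendsto_of_tendsto (((hJc r).tendsto 0).mono_left (nhdsWithin_le_nhds (s := Ioi 0)))
      (((hJc s).tendsto 0).mono_left nhdsWithin_le_nhds) ?_
    filter_upwards [self_mem_nhdsWithin] with ε hε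
    exact circle_integral_regularized_mono hf (by positivity) hε hr hrs
  have := eLpNorm_circleMeasure_le hq (hfc.comp (continuous_circle r))
    (hfc.comp (continuous_circle s)) zero_le_one (by rw [one_mul]; exact hle)
  simpa [circleNorm, Function.comp_def] using this

/-- By the mean value property the conjugate of A has mean zero, so B(0) is the mean of the sum; the
measure being a probability, its modulus is at most the L^q norm. -/
theorem enorm_apply_zero_le_eLpNorm {q : ℝ} (hq : 1 ≤ q) {A B : ℂ → ℂ} (hA : Differentiable ℂ A)
    (hB : Differentiable ℂ B) (hA0 : A 0 = 0) :
    ‖B 0‖ₑ ≤ eLpNorm (fun θ : ℝ => (starRingEnd ℂ) (A (Complex.exp (θ * Complex.I))) +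
      B (Complex.exp (θ * Complex.I))) (ENNReal.ofReal q) circleMeasure := by
  have hAc := hA.continuous
  have hBc := hB.continuous
  have mean : ∀ F : ℂ → ℂ, Differentiable ℂ F →
      ∫ θ, F (Complex.exp (θ * Complex.I)) ∂circleMeasure = F 0 := by
    intro F hF
    have h := DiffContOnCl.circleAverage (hF.diffContOnCl (s := Metric.ball 0 |1|))
    rw [Real.circleAverage_def] at h
    rw [← h, circleMeasure, integral_smul_measure,
      ENNReal.toReal_ofReal (by positivity), intervalIntegral.integral_of_le Real.two_pi_pos.le]
    simp [circleMap]
  have int : ∀ h : ℝ → ℂ, Continuous h → Integrable h circleMeasure := fun h hc =>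
    Integrable.smul_measure hc.integrableOn_Ioc ENNReal.ofReal_ne_top
  have key : ∫ θ : ℝ, ((starRingEnd ℂ) (A (Complex.exp (θ * Complex.I))) +
      B (Complex.exp (θ * Complex.I))) ∂circleMeasure = B 0 := by
    rw [integral_add (int _ (by fun_prop)) (int _ (by fun_prop)), mean B hB, integral_conj,
      mean A hA, hA0]
    simp
  calc ‖B 0‖ₑ ≤ ∫⁻ θ : ℝ, ‖(starRingEnd ℂ) (A (Complex.exp (θ * Complex.I))) +
      B (Complex.exp (θ * Complex.I))‖ₑ ∂circleMeasure := by
        rw [← key]; exact enorm_integral_le_lintegral_enorm _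
    _ = eLpNorm (fun θ : ℝ => (starRingEnd ℂ) (A (Complex.exp (θ * Complex.I))) +
      B (Complex.exp (θ * Complex.I))) 1 circleMeasure := eLpNorm_one_eq_lintegral_enorm.symm
    _ ≤ _ := eLpNorm_le_eLpNorm_of_exponent_le (by simpa using hq)
        (by fun_prop : Continuous _).aestronglyMeasurable

/-- Boundedness of the Riesz projection in `L^q` of the circle. -/
theorem exists_riesz_projection_bound {q : ℝ} (hq : 1 < q) : ∃ C : ℝ≥0∞, C ≠ ∞ ∧ ∀ A B : ℂ → ℂ,
    Differentiable ℂ A → Differentiable ℂ B → A 0 = 0 →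
    eLpNorm (fun θ : ℝ => B (Complex.exp (θ * Complex.I))) (ENNReal.ofReal q) circleMeasure ≤
      C * eLpNorm (fun θ : ℝ => (starRingEnd ℂ) (A (Complex.exp (θ * Complex.I))) +
        B (Complex.exp (θ * Complex.I))) (ENNReal.ofReal q) circleMeasure := by
  obtain ⟨K, hK, hRiesz⟩ := exists_circle_integral_le_re hq
  have hq0 : 0 < q := by linarith
  have hq1 : 1 ≤ ENNReal.ofReal q := by simpa using hq.le
  set K' := ENNReal.ofReal (K ^ (1 / q))
  have hK' : K' ≠ ∞ := ENNReal.ofReal_ne_top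
  refine ⟨4 * K' + 1, by finiteness, fun A B hA hB hA0 => ?_⟩
  have hAc := hA.continuous
  have hBc := hB.continuous
  set T : ℝ → ℂ := fun θ => (starRingEnd ℂ) (A (Complex.exp (θ * Complex.I))) +
        B (Complex.exp (θ * Complex.I)) with hT
  have hTc : Continuous T := by fun_prop
  set N := eLpNorm T (ENNReal.ofReal q) circleMeasure
  have hB0 : ‖B 0‖ₑ ≤ N := enorm_apply_zero_le_eLpNorm hq.le hA hB hA0
  have hconst : ∀ c : ℂ, eLpNorm (fun _ : ℝ => c) (ENNReal.ofReal q) circleMeasure = ‖c‖ₑ := by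
    intro c
    rw [eLpNorm_const' _ (by simpa using hq0) ENNReal.ofReal_ne_top]
    simp
  have hT' : eLpNorm (fun θ => T θ - B 0) (ENNReal.ofReal q) circleMeasure ≤ 2 * N := by
    refine (eLpNorm_sub_le hTc.aestronglyMeasurable aestronglyMeasurable_const hq1).trans ?_
    rw [hconst, two_mul]
    gcongr
  -- Riesz's inequality is applied to A + (B - B(0)) and to -i((B - B(0)) - A), whose real parts on
  -- the circle are the real and imaginary parts of T - B(0). Half the first plus i/2 times the
  -- second recovers B - B(0).
  have main : ∀ c : ℂ, ‖c‖ = 1 → ∀ F : ℂ → ℂ, Differentiable ℂ F → F 0 = 0 →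
      (∀ θ : ℝ, (F (Complex.exp (θ * Complex.I))).re = (c * (T θ - B 0)).re) →
      eLpNorm (fun θ : ℝ => F (Complex.exp (θ * Complex.I))) (ENNReal.ofReal q) circleMeasure ≤
        K' * (2 * N) := by
    intro c hc F hF hF0 hre
    have hFc := hF.continuous
    have h1 := hRiesz F hF hF0 1 zero_le_one
    simp only [Complex.ofReal_one, one_mul] at h1
    refine (eLpNorm_circleMeasure_le hq0 (k := fun θ : ℝ => (F (Complex.exp (θ * Complex.I))).re)
      (by fun_prop) (by fun_prop) hK.le (by simpa using h1)).trans ?_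
    gcongr
    refine (eLpNorm_mono fun θ => ?_).trans hT'
    rw [hre θ, Real.norm_eq_abs]
    refine (Complex.abs_re_le_norm _).trans ?_
    simp [hc]
  have m1 := main 1 (by simp) (fun z => A z + (B z - B 0)) (hA.add (hB.sub_const _)) (by simp [hA0])
    (fun θ => by simp [hT]; ring)
  have m2 := main (-Complex.I) (by simp) (fun z => -Complex.I * ((B z - B 0) - A z))
    (((hB.sub_const _).sub hA).const_mul _) (by simp [hA0]) (fun θ => by simp [hT]; ring)
  have e : (fun θ : ℝ => B (Complex.exp (θ * Complex.I))) = (((fun θ : ℝ =>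
      (1 / 2 : ℂ) * (A (Complex.exp (θ * Complex.I)) + (B (Complex.exp (θ * Complex.I)) - B 0))) +
      fun θ : ℝ => (1 / 2 * Complex.I : ℂ) * (-Complex.I * ((B (Complex.exp (θ * Complex.I)) - B 0) -
        A (Complex.exp (θ * Complex.I))))) + fun _ => B 0) := by
    funext θ
    simp only [Pi.add_apply]
    linear_combination (1 / 2 : ℂ) * ((B (Complex.exp (θ * Complex.I)) - B 0) -
        A (Complex.exp (θ * Complex.I))) * Complex.I_sq
  have half : ∀ (c : ℂ) (h : ℝ → ℂ), ‖c‖ ≤ 1 →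
      eLpNorm (fun θ => c * h θ) (ENNReal.ofReal q) circleMeasure ≤
      eLpNorm h (ENNReal.ofReal q) circleMeasure := fun c h hc => eLpNorm_mono fun θ => by
    rw [norm_mul]; exact mul_le_of_le_one_left (norm_nonneg _) hc
  rw [e]
  refine (eLpNorm_add_le (by fun_prop : Continuous _).aestronglyMeasurable
    aestronglyMeasurable_const hq1).trans ?_
  refine (add_le_add (eLpNorm_add_le (by fun_prop : Continuous _).aestronglyMeasurable
    (by fun_prop : Continuous _).aestronglyMeasurable hq1) le_rfl).trans ?_
  rw [hconst]
  calc _ ≤ K' * (2 * N) + K' * (2 * N) + N := by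
        refine add_le_add (add_le_add ((half _ _ (by norm_num)).trans m1)
          ((half _ _ (by norm_num)).trans m2)) hB0
    _ = (4 * K' + 1) * N := by ring

/-! ### Polynomials: partial sums and change of radius. -/

/-- The polynomial with coefficients `a k`, `k ∈ s`. -/
noncomputable def coeffSum (a : ℕ → ℂ) (s : Finset ℕ) (z : ℂ) : ℂ := ∑ k ∈ s, a k * z ^ k

theorem differentiable_coeffSum (a : ℕ → ℂ) (s : Finset ℕ) : Differentiable ℂ (coeffSum a s) := by
  unfold coeffSum; fun_prop

theorem continuous_circle_coeffSum (a : ℕ → ℂ) (s : Finset ℕ) (r : ℝ) :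
    Continuous fun θ : ℝ => coeffSum a s (r * Complex.exp (θ * Complex.I)) :=
  (differentiable_coeffSum a s).continuous.comp (continuous_circle r)

/-- Absorbing the dilation into the coefficients transfers multiplier bounds on the unit circle to
every radius with the same constant. -/
theorem circleNorm_eq_one (q r : ℝ) (a : ℕ → ℂ) (s : Finset ℕ) :
    circleNorm q r (coeffSum a s) = circleNorm q 1 (coeffSum (fun k => a k * r ^ k) s) := by
  simp only [circleNorm, coeffSum, Complex.ofReal_one, one_mul, mul_pow, mul_assoc]

theorem norm_exp_mul_I_pow (θ : ℝ) (n : ℕ) : ‖Complex.exp (θ * Complex.I) ^ n‖ = 1 := by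
  rw [norm_pow, Complex.norm_exp_ofReal_mul_I, one_pow]

theorem exp_pow_mul_conj (θ : ℝ) {k n : ℕ} (h : k ≤ n) : Complex.exp (θ * Complex.I) ^ n *
    (starRingEnd ℂ) (Complex.exp (θ * Complex.I) ^ (n - k)) = Complex.exp (θ * Complex.I) ^ k := by
  obtain ⟨m, rfl⟩ := Nat.exists_eq_add_of_le h
  rw [Nat.add_sub_cancel_left, pow_add, mul_assoc, Complex.mul_conj, Complex.normSq_eq_norm_sq,
    norm_exp_mul_I_pow]
  simp

/-- Dividing by z^M does not change moduli on the unit circle and turns the terms of degree below M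
into the conjugate of a polynomial vanishing at 0; the Riesz projection then removes exactly those
terms. -/
theorem exists_circleNorm_tail_le {q : ℝ} (hq : 1 < q) : ∃ C : ℝ≥0∞, C ≠ ∞ ∧
    ∀ (a : ℕ → ℂ) (M N : ℕ), M ≤ N →
    circleNorm q 1 (coeffSum a (Finset.Ico M N)) ≤
      C * circleNorm q 1 (coeffSum a (Finset.range N)) := by
  obtain ⟨C, hC, h⟩ := exists_riesz_projection_bound hq
  refine ⟨C, hC, fun a M N hMN => ?_⟩
  have key := h (fun z => ∑ k ∈ Finset.range M, (starRingEnd ℂ) (a k) * z ^ (M - k))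
    (fun z => ∑ k ∈ Finset.Ico M N, a k * z ^ (k - M)) (by fun_prop) (by fun_prop)
    (Finset.sum_eq_zero fun k hk => by
      rw [zero_pow (Nat.sub_ne_zero_of_lt (Finset.mem_range.1 hk)), mul_zero])
  have e0 : ∀ z : ℂ, z ^ M * ∑ k ∈ Finset.Ico M N, a k * z ^ (k - M) =
      coeffSum a (Finset.Ico M N) z := by
    intro z
    rw [Finset.mul_sum]
    refine Finset.sum_congr rfl fun k hk => ?_
    rw [mul_left_comm, ← pow_add, Nat.add_sub_cancel' (Finset.mem_Ico.1 hk).1]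
  have e1 : ∀ θ : ℝ, Complex.exp (θ * Complex.I) ^ M * (starRingEnd ℂ)
      (∑ k ∈ Finset.range M, (starRingEnd ℂ) (a k) * Complex.exp (θ * Complex.I) ^ (M - k)) =
      coeffSum a (Finset.range M) (Complex.exp (θ * Complex.I)) := by
    intro θ
    rw [map_sum, Finset.mul_sum]
    refine Finset.sum_congr rfl fun k hk => ?_
    rw [map_mul, Complex.conj_conj, mul_left_comm, exp_pow_mul_conj θ (Finset.mem_range.1 hk).le]
  have e2 : ∀ z : ℂ, coeffSum a (Finset.range N) z =
      coeffSum a (Finset.range M) z + coeffSum a (Finset.Ico M N) z := fun z =>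
    (Finset.sum_range_add_sum_Ico _ hMN).symm
  unfold circleNorm
  simp only [Complex.ofReal_one, one_mul]
  refine (eLpNorm_congr_norm_ae ?_).trans_le
    (key.trans_eq (congrArg (C * ·) (eLpNorm_congr_norm_ae ?_)))
  · refine Eventually.of_forall fun θ => ?_
    rw [← e0, norm_mul, norm_exp_mul_I_pow, one_mul]
  · refine Eventually.of_forall fun θ => ?_
    rw [e2, ← e0, ← e1, ← mul_add, norm_mul, norm_exp_mul_I_pow, one_mul]

theorem circleNorm_add_le {q : ℝ} (hq : 1 ≤ q) {r : ℝ} {f g : ℂ → ℂ}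
    (hf : Continuous fun θ : ℝ => f (r * Complex.exp (θ * Complex.I)))
    (hg : Continuous fun θ : ℝ => g (r * Complex.exp (θ * Complex.I))) :
    circleNorm q r (fun z => f z + g z) ≤ circleNorm q r f + circleNorm q r g :=
  eLpNorm_add_le hf.aestronglyMeasurable hg.aestronglyMeasurable (by simpa using hq)

theorem circleNorm_le_add_of_norm_sub_le {q : ℝ} (hq : 1 ≤ q) {r ε : ℝ} {f g : ℂ → ℂ}
    (hf : Continuous fun θ : ℝ => f (r * Complex.exp (θ * Complex.I)))
    (hg : Continuous fun θ : ℝ => g (r * Complex.exp (θ * Complex.I)))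
    (h : ∀ θ : ℝ, ‖f (r * Complex.exp (θ * Complex.I)) - g (r * Complex.exp (θ * Complex.I))‖ ≤ ε) :
    circleNorm q r f ≤ circleNorm q r g + ENNReal.ofReal ε := by
  have h1 := circleNorm_add_le hq hg (f := g) (g := fun z => f z - g z) (hf.sub hg)
  simp only [add_sub_cancel] at h1
  refine h1.trans (add_le_add le_rfl ?_)
  refine (eLpNorm_le_of_ae_bound (Eventually.of_forall h)).trans ?_
  simp

/-- Boundedness of the partial sum operators on the circle of radius `r`. -/
theorem exists_circleNorm_block_le {q : ℝ} (hq : 1 < q) : ∃ C : ℝ≥0∞, C ≠ ∞ ∧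
    ∀ (r : ℝ) (a : ℕ → ℂ) (M M' N : ℕ), M ≤ M' → M' ≤ N →
    circleNorm q r (coeffSum a (Finset.Ico M M')) ≤
      C * circleNorm q r (coeffSum a (Finset.range N)) := by
  obtain ⟨C, hC, h⟩ := exists_circleNorm_tail_le hq
  refine ⟨2 * C, by finiteness, fun r a M M' N h1 h2 => ?_⟩
  rw [circleNorm_eq_one, circleNorm_eq_one q r a]
  generalize (fun k => a k * (r : ℂ) ^ k) = a
  have e : coeffSum a (Finset.Ico M M') =
      coeffSum a (Finset.Ico M N) - coeffSum a (Finset.Ico M' N) := by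
    funext z
    exact eq_sub_of_add_eq (Finset.sum_Ico_consecutive _ h1 h2)
  rw [e, two_mul, add_mul]
  refine le_trans ?_ (add_le_add (h a M N (h1.trans h2)) (h a M' N h2))
  exact eLpNorm_sub_le (continuous_circle_coeffSum _ _ _).aestronglyMeasurable
    (continuous_circle_coeffSum _ _ _).aestronglyMeasurable (by simpa using hq.le)

/-- After the factor z^M is taken out, what remains is still a polynomial, whose circular norms
increase with the radius. -/
theorem circleNorm_coeffSum_le {q : ℝ} (hq : 0 < q) {r : ℝ} (hr : 0 ≤ r) (hr1 : r ≤ 1) (a : ℕ → ℂ)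
    {M : ℕ} {s : Finset ℕ} (hs : ∀ k ∈ s, M ≤ k) :
    circleNorm q r (coeffSum a s) ≤ ENNReal.ofReal (r ^ M) * circleNorm q 1 (coeffSum a s) := by
  set h : ℂ → ℂ := fun z => ∑ k ∈ s, a k * z ^ (k - M) with hh
  have hd : Differentiable ℂ h := by rw [hh]; fun_prop
  have e : ∀ z : ℂ, coeffSum a s z = z ^ M * h z := by
    intro z
    rw [hh, Finset.mul_sum]
    refine Finset.sum_congr rfl fun k hk => ?_
    rw [mul_left_comm, ← pow_add, Nat.add_sub_cancel' (hs k hk)]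
  have norm_eq : ∀ t : ℝ, 0 ≤ t → circleNorm q t (coeffSum a s) =
      ENNReal.ofReal (t ^ M) * circleNorm q t h := by
    intro t ht
    unfold circleNorm
    rw [eLpNorm_congr_norm_ae (g := fun θ : ℝ => (t ^ M : ℝ) •
      h (t * Complex.exp (θ * Complex.I)))]
    · rw [show (fun θ : ℝ => (t ^ M : ℝ) • h (t * Complex.exp (θ * Complex.I))) =
        (t ^ M : ℝ) • fun θ : ℝ => h (t * Complex.exp (θ * Complex.I)) from rfl,
        eLpNorm_const_smul, Real.enorm_of_nonneg (by positivity)]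
    · refine Eventually.of_forall fun θ => ?_
      rw [e, mul_pow, norm_mul, norm_mul, norm_exp_mul_I_pow, norm_smul]
      simp
  rw [norm_eq r hr, norm_eq 1 zero_le_one]
  simp only [one_pow, ENNReal.ofReal_one, one_mul]
  gcongr
  exact circleNorm_mono_radius hq hd hr hr1

/-- The reversed polynomial with conjugate coefficients, evaluated at radius 1/t, has the modulus of
the original at radius t divided by t^N. Its norms increase with 1/t, which turns monotonicity into
a lower bound at the smaller radius. -/
theorem le_circleNorm_coeffSum {q : ℝ} (hq : 0 < q) {r : ℝ} (hr : 0 < r) (hr1 : r ≤ 1) (a : ℕ → ℂ)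
    {N : ℕ} {s : Finset ℕ} (hs : ∀ k ∈ s, k ≤ N) :
    ENNReal.ofReal (r ^ N) * circleNorm q 1 (coeffSum a s) ≤ circleNorm q r (coeffSum a s) := by
  set h : ℂ → ℂ := fun z => ∑ k ∈ s, (starRingEnd ℂ) (a k) * z ^ (N - k) with hh
  have hd : Differentiable ℂ h := by rw [hh]; fun_prop
  have e : ∀ (t θ : ℝ), 0 < t → coeffSum a s (t * Complex.exp (θ * Complex.I)) =
      (t * Complex.exp (θ * Complex.I)) ^ N *
        (starRingEnd ℂ) (h ((t⁻¹ : ℝ) * Complex.exp (θ * Complex.I))) := by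
    intro t θ ht
    rw [hh, map_sum, Finset.mul_sum]
    refine Finset.sum_congr rfl fun k hk => ?_
    rw [map_mul, Complex.conj_conj, mul_left_comm, mul_pow, mul_pow, mul_pow, map_mul,
      mul_mul_mul_comm, exp_pow_mul_conj θ (hs k hk), map_pow _ ((t⁻¹ : ℝ) : ℂ),
      Complex.conj_ofReal]
    congr 2
    have : (t : ℂ) ≠ 0 := by exact_mod_cast ht.ne'
    push_cast
    rw [inv_pow, eq_mul_inv_iff_mul_eq₀ (pow_ne_zero _ this), ← pow_add,
      Nat.add_sub_cancel' (hs k hk)]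
  have norm_eq : ∀ t : ℝ, 0 < t → circleNorm q t (coeffSum a s) =
      ENNReal.ofReal (t ^ N) * circleNorm q t⁻¹ h := by
    intro t ht
    unfold circleNorm
    rw [eLpNorm_congr_norm_ae (g := fun θ : ℝ => (t ^ N : ℝ) •
      h ((t⁻¹ : ℝ) * Complex.exp (θ * Complex.I)))]
    · rw [show (fun θ : ℝ => (t ^ N : ℝ) • h ((t⁻¹ : ℝ) * Complex.exp (θ * Complex.I))) =
        (t ^ N : ℝ) • fun θ : ℝ => h ((t⁻¹ : ℝ) * Complex.exp (θ * Complex.I)) from rfl,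
        eLpNorm_const_smul, Real.enorm_of_nonneg (by positivity)]
    · refine Eventually.of_forall fun θ => ?_
      rw [e t θ ht, mul_pow, norm_mul, norm_mul, norm_exp_mul_I_pow, norm_smul, RCLike.norm_conj]
      simp
  rw [norm_eq r hr, norm_eq 1 one_pos]
  simp only [one_pow, ENNReal.ofReal_one, one_mul, inv_one]
  gcongr
  exact circleNorm_mono_radius hq hd zero_le_one (one_le_inv₀ hr |>.2 hr1)

/-! ### Taylor approximation on circles and Hardy norms of polynomials. -/

theorem eventually_norm_sub_coeffSum_le {g : ℂ → ℂ} (hg : DifferentiableOn ℂ g (Metric.ball 0 1))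
    {r : ℝ} (hr : 0 ≤ r) (hr1 : r < 1) {ε : ℝ} (hε : 0 < ε) :
    ∀ᶠ N in atTop, ∀ θ : ℝ, ‖g (r * Complex.exp (θ * Complex.I)) -
      coeffSum (MixedNorm.maclaurinCoeff g) (Finset.range N) (r * Complex.exp (θ * Complex.I))‖ ≤ ε := by
  have hsum : ∀ z ∈ Metric.ball (0 : ℂ) 1,
      HasSum (fun k => MixedNorm.maclaurinCoeff g k * z ^ k) (g z) := by
    intro z hz
    refine (Complex.hasSum_taylorSeries_on_ball hg hz).congr_fun fun k => ?_
    simp only [MixedNorm.maclaurinCoeff, sub_zero, smul_eq_mul, div_eq_mul_inv]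
    ring
  have hu : Summable fun k => ‖MixedNorm.maclaurinCoeff g k * (r : ℂ) ^ k‖ :=
    (hsum r (by simpa [abs_of_nonneg hr] using hr1)).summable.norm
  have hunif := tendstoUniformlyOn_tsum_nat hu (s := Metric.sphere (0 : ℂ) r)
    (f := fun k z => MixedNorm.maclaurinCoeff g k * z ^ k) fun k z hz => by
      rw [norm_mul, norm_mul, norm_pow, norm_pow, mem_sphere_zero_iff_norm.1 hz]
      simp [abs_of_nonneg hr]
  filter_upwards [Metric.tendstoUniformlyOn_iff.1 hunif ε hε] with N hN θ
  have hmem : (r * Complex.exp (θ * Complex.I) : ℂ) ∈ Metric.sphere (0 : ℂ) r := by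
    simp [Complex.norm_exp_ofReal_mul_I, abs_of_nonneg hr]
  have h1 := hN _ hmem
  rw [(hsum _ (by rw [mem_ball_zero_iff, mem_sphere_zero_iff_norm.1 hmem]; exact hr1)).tsum_eq,
    dist_eq_norm] at h1
  exact h1.le

theorem continuous_circle_of_differentiableOn {g : ℂ → ℂ}
    (hg : DifferentiableOn ℂ g (Metric.ball 0 1)) {r : ℝ} (hr : 0 ≤ r) (hr1 : r < 1) :
    Continuous fun θ : ℝ => g (r * Complex.exp (θ * Complex.I)) :=
  hg.continuousOn.comp_continuous (continuous_circle r) fun θ => by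
    simpa [Complex.norm_exp_ofReal_mul_I, abs_of_nonneg hr] using hr1

/-- A polynomial is continuous up to the unit circle, so the limit defining the Hardy norm exists
and `limUnder` returns it. -/
theorem hardyNorm_coeffSum {q : ℝ} (hq : 0 < q) (a : ℕ → ℂ) (s : Finset ℕ) :
    MixedNorm.hardyNorm q (coeffSum a s) = circleNorm q 1 (coeffSum a s) := by
  rw [← ofReal_integralMean hq (continuous_circle_coeffSum a s 1)]
  refine Tendsto.limUnder_eq ?_
  refine (ENNReal.continuous_ofReal.tendsto _).comp (Tendsto.mono_left ?_ nhdsWithin_le_nhds)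
  have hc := (differentiable_coeffSum a s).continuous
  refine Continuous.tendsto ?_ 1
  unfold MixedNorm.integralMean
  refine Continuous.rpow_const (continuous_const.mul ?_) fun _ => Or.inr (by positivity)
  apply intervalIntegral.continuous_parametric_intervalIntegral_of_continuous'
  exact Continuous.rpow_const (by fun_prop) fun _ => Or.inr hq.le

/-! ### Regular weights: geometry of the points r_n and the indices M_n. -/

namespace MixedNorm

variable {ω : ℝ → ℝ}

theorem IsRegularWeight.tail_pos (h : IsRegularWeight ω) {r : ℝ} (hr : r ∈ Ico (0 : ℝ) 1) :
    0 < tail ω r := by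
  have := h.tail_strictAntiOn (Ico_subset_Icc_self hr) (right_mem_Icc.2 zero_le_one) hr.2
  simpa [tail] using this

theorem IsRegularWeight.continuousOn_tail (h : IsRegularWeight ω) :
    ContinuousOn (tail ω) (Icc (0 : ℝ) 1) := by
  have hI : IntegrableOn ω (uIcc (0 : ℝ) 1) := by
    rw [uIcc_of_le zero_le_one, integrableOn_Icc_iff_integrableOn_Ico]; exact h.integrableOn
  have := intervalIntegral.continuousOn_primitive_interval_left hI
  rwa [uIcc_of_le zero_le_one] at this

theorem IsRegularWeight.hasDerivAt_tail (h : IsRegularWeight ω) {r : ℝ} (hr : r ∈ Ioo (0 : ℝ) 1) :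
    HasDerivAt (tail ω) (-ω r) r := by
  have hnhds : Ico (0 : ℝ) 1 ∈ 𝓝 r := Ico_mem_nhds hr.1 hr.2
  have hmeas : StronglyMeasurableAtFilter ω (𝓝 r) volume :=
    ⟨_, hnhds, h.integrableOn.aestronglyMeasurable⟩
  exact intervalIntegral.integral_hasDerivAt_left
    (h.intervalIntegrable ⟨hr.1.le, hr.2.le⟩ (right_mem_Icc.2 zero_le_one)) hmeas
    (h.continuousOn.continuousAt hnhds)

/-- Comparing the tail with (1-r)^κ: the sign of this derivative is decided by the distortion
bounds. -/
theorem IsRegularWeight.hasDerivAt_log (h : IsRegularWeight ω) (κ : ℝ) {r : ℝ}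
    (hr : r ∈ Ioo (0 : ℝ) 1) :
    HasDerivAt (fun r => Real.log (tail ω r) - κ * Real.log (1 - r))
      (-ω r / tail ω r + κ / (1 - r)) r := by
  have hpos := h.tail_pos (Ioo_subset_Ico_self hr)
  have h1 := (h.hasDerivAt_tail hr).log hpos.ne'
  have h2 := (((hasDerivAt_id r).const_sub 1).log (by simp only [id]; linarith [hr.2])).const_mul κ
  refine (h1.sub h2).congr_deriv ?_
  simp only [id]
  ring

theorem IsRegularWeight.continuousOn_log (h : IsRegularWeight ω) (κ : ℝ) :
    ContinuousOn (fun r => Real.log (tail ω r) - κ * Real.log (1 - r)) (Ico (0 : ℝ) 1) :=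
  ((h.continuousOn_tail.mono Ico_subset_Icc_self).log fun _ hr => (h.tail_pos hr).ne').sub
    (continuousOn_const.mul ((continuousOn_const.sub continuousOn_id).log fun _ hr =>
      (sub_pos.2 hr.2).ne'))

theorem IsRegularWeight.strictMono_rSeq (h : IsRegularWeight ω)
    (h1 : ∫ r in (0 : ℝ)..1, ω r = 1) : StrictMono (rSeq ω) := by
  refine strictMono_nat_of_lt_succ fun n => ?_
  rw [← h.tail_strictAntiOn.lt_iff_gt (Ico_subset_Icc_self (h.rSeq_mem h1 _))
    (Ico_subset_Icc_self (h.rSeq_mem h1 _)), h.tail_rSeq h1, h.tail_rSeq h1]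
  exact one_div_pow_lt_one_div_pow_of_lt one_lt_two n.lt_succ_self

theorem IsRegularWeight.rSeq_zero (h : IsRegularWeight ω) (h1 : ∫ r in (0 : ℝ)..1, ω r = 1) :
    rSeq ω 0 = 0 :=
  (h.eq_rSeq ⟨le_rfl, one_pos⟩ (by simpa [tail] using h1)).symm

theorem IsRegularWeight.one_sub_rSeq_pos (h : IsRegularWeight ω)
    (h1 : ∫ r in (0 : ℝ)..1, ω r = 1) (n : ℕ) : 0 < 1 - rSeq ω n := by
  linarith [(h.rSeq_mem h1 n).2]

/-- The distances `1 - r_n` decay geometrically, from above and from below. -/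
theorem IsRegularWeight.exists_ratio_bounds (h : IsRegularWeight ω)
    (h1 : ∫ r in (0 : ℝ)..1, ω r = 1) : ∃ a b : ℝ, 1 < a ∧ 1 < b ∧ ∀ n m : ℕ,
      a ^ m * (1 - rSeq ω (n + m)) ≤ 1 - rSeq ω n ∧
        1 - rSeq ω n ≤ b ^ m * (1 - rSeq ω (n + m)) := by
  obtain ⟨c, C, hc, hC, hdist⟩ := h.distortion_comparable
  have hlog2 : 0 < Real.log 2 := Real.log_pos one_lt_two
  have ratio : ∀ r ∈ Ioo (0 : ℝ) 1, c * (1 - r) * ω r ≤ tail ω r ∧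
      tail ω r ≤ C * (1 - r) * ω r := by
    intro r hr
    have hω := h.pos r (Ioo_subset_Ico_self hr)
    obtain ⟨h2, h3⟩ := hdist r (Ioo_subset_Ico_self hr)
    rw [distortion, one_div_mul_eq_div] at h2 h3
    exact ⟨(le_div_iff₀ hω).1 h2, (div_le_iff₀ hω).1 h3⟩
  -- The upper distortion bound says that the tail divided by (1-r)^{1/C} decreases; the lower one
  -- that the tail divided by (1-r)^{1/c} increases. As the tail halves from r_n to r_{n+1}, the
  -- ratios of 1 - r_n lie between 2^c and 2^C.
  have anti : AntitoneOn (fun r => Real.log (tail ω r) - 1 / C * Real.log (1 - r))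
      (Ico (0 : ℝ) 1) := by
    refine antitoneOn_of_deriv_nonpos (convex_Ico 0 1) (h.continuousOn_log _) ?_ ?_
    · rw [interior_Ico]
      exact fun r hr => (h.hasDerivAt_log _ hr).differentiableAt.differentiableWithinAt
    · rw [interior_Ico]
      intro r hr
      have ht := h.tail_pos (Ioo_subset_Ico_self hr)
      have hx : 0 < 1 - r := by linarith [hr.2]
      rw [(h.hasDerivAt_log _ hr).deriv, neg_div, neg_add_nonpos_iff, div_div,
        div_le_div_iff₀ (by positivity) ht]
      linarith [(ratio r hr).2]
  have mono : MonotoneOn (fun r => Real.log (tail ω r) - 1 / c * Real.log (1 - r))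
      (Ico (0 : ℝ) 1) := by
    refine monotoneOn_of_deriv_nonneg (convex_Ico 0 1) (h.continuousOn_log _) ?_ ?_
    · rw [interior_Ico]
      exact fun r hr => (h.hasDerivAt_log _ hr).differentiableAt.differentiableWithinAt
    · rw [interior_Ico]
      intro r hr
      have ht := h.tail_pos (Ioo_subset_Ico_self hr)
      have hx : 0 < 1 - r := by linarith [hr.2]
      rw [(h.hasDerivAt_log _ hr).deriv, neg_div, le_neg_add_iff_add_le, add_zero, div_div,
        div_le_div_iff₀ ht (by positivity)]
      linarith [(ratio r hr).1]
  have hpow : ∀ (κ : ℝ) (m : ℕ), ((2 : ℝ) ^ κ) ^ m = Real.exp (m * κ * Real.log 2) := by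
    intro κ m
    rw [← Real.rpow_natCast, ← Real.rpow_mul zero_le_two, Real.rpow_def_of_pos two_pos]
    congr 1; ring
  refine ⟨2 ^ c, 2 ^ C, Real.one_lt_rpow one_lt_two hc, Real.one_lt_rpow one_lt_two hC,
    fun n m => ?_⟩
  have hle := (h.strictMono_rSeq h1).monotone (Nat.le_add_right n m)
  have hxn := h.one_sub_rSeq_pos h1 n
  have hxm := h.one_sub_rSeq_pos h1 (n + m)
  have A := anti (h.rSeq_mem h1 n) (h.rSeq_mem h1 (n + m)) hle
  have B := mono (h.rSeq_mem h1 n) (h.rSeq_mem h1 (n + m)) hle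
  have ht : ∀ k, Real.log (tail ω (rSeq ω k)) = -(k * Real.log 2) := by
    intro k
    rw [h.tail_rSeq h1, one_div, Real.log_inv, Real.log_pow]
  simp only [ht] at A B
  push_cast at A B
  have A' : Real.log (1 - rSeq ω n) ≤ m * C * Real.log 2 + Real.log (1 - rSeq ω (n + m)) := by
    have : 1 / C * (Real.log (1 - rSeq ω n) - Real.log (1 - rSeq ω (n + m))) ≤ m * Real.log 2 := by
      linarith
    rw [one_div_mul_eq_div, div_le_iff₀ hC] at this
    linarith
  have B' : m * c * Real.log 2 + Real.log (1 - rSeq ω (n + m)) ≤ Real.log (1 - rSeq ω n) := by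
    have : m * Real.log 2 ≤ 1 / c * (Real.log (1 - rSeq ω n) - Real.log (1 - rSeq ω (n + m))) := by
      linarith
    rw [one_div_mul_eq_div, le_div_iff₀ hc] at this
    linarith
  rw [hpow, hpow]
  have A2 := Real.exp_le_exp.2 A'
  have B2 := Real.exp_le_exp.2 B'
  rw [Real.exp_add, Real.exp_log hxn, Real.exp_log hxm] at A2 B2
  exact ⟨B2, A2⟩

theorem IsRegularWeight.tendsto_rSeq (h : IsRegularWeight ω) (h1 : ∫ r in (0 : ℝ)..1, ω r = 1) :
    Tendsto (rSeq ω) atTop (𝓝 1) := by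
  obtain ⟨a, b, ha, -, hab⟩ := h.exists_ratio_bounds h1
  have h2 : Tendsto (fun n : ℕ => 1 - (a⁻¹) ^ n) atTop (𝓝 (1 - 0)) :=
    tendsto_const_nhds.sub (tendsto_pow_atTop_nhds_zero_of_lt_one (by positivity)
      (inv_lt_one_of_one_lt₀ ha))
  rw [sub_zero] at h2
  refine tendsto_of_tendsto_of_tendsto_of_le_of_le h2 tendsto_const_nhds (fun n => ?_)
    fun n => (h.rSeq_mem h1 n).2.le
  have h3 := (hab 0 n).1
  rw [h.rSeq_zero h1, zero_add, sub_zero] at h3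
  have h4 : 0 < a ^ n := by positivity
  have h5 : 1 - rSeq ω n ≤ (a⁻¹) ^ n := by
    rw [inv_pow, ← one_div, le_div_iff₀ h4]; linarith
  simp only
  linarith

theorem blockIndex_le (h : IsRegularWeight ω) (h1 : ∫ r in (0 : ℝ)..1, ω r = 1) (n : ℕ) :
    (blockIndex ω n : ℝ) * (1 - rSeq ω n) ≤ 1 := by
  have hx := h.one_sub_rSeq_pos h1 n
  rw [← le_div_iff₀ hx]
  exact Nat.floor_le (by positivity)

theorem one_le_blockIndex (h : IsRegularWeight ω) (h1 : ∫ r in (0 : ℝ)..1, ω r = 1) (n : ℕ) :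
    1 ≤ blockIndex ω n := by
  have hx := h.one_sub_rSeq_pos h1 n
  rw [blockIndex, Nat.one_le_floor_iff, le_div_iff₀ hx]
  linarith [(h.rSeq_mem h1 n).1]

theorem one_lt_blockIndex_add_one (h : IsRegularWeight ω) (h1 : ∫ r in (0 : ℝ)..1, ω r = 1)
    (n : ℕ) : 1 < ((blockIndex ω n : ℝ) + 1) * (1 - rSeq ω n) := by
  have hx := h.one_sub_rSeq_pos h1 n
  rw [← div_lt_iff₀ hx]
  exact Nat.lt_floor_add_one _

/-- Rounding down loses at most a factor 2 since M_n ≥ 1. -/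
theorem one_lt_two_mul_blockIndex (h : IsRegularWeight ω) (h1 : ∫ r in (0 : ℝ)..1, ω r = 1)
    (n : ℕ) : 1 < 2 * (blockIndex ω n : ℝ) * (1 - rSeq ω n) := by
  have hx := h.one_sub_rSeq_pos h1 n
  have h2 : (1 : ℝ) ≤ blockIndex ω n := by exact_mod_cast one_le_blockIndex h h1 n
  nlinarith [one_lt_blockIndex_add_one h h1 n]

theorem monotone_blockIndex (h : IsRegularWeight ω) (h1 : ∫ r in (0 : ℝ)..1, ω r = 1) :
    Monotone (blockIndex ω) := by
  intro m n hmn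
  refine Nat.floor_mono (one_div_le_one_div_of_le (h.one_sub_rSeq_pos h1 n) ?_)
  linarith [(h.strictMono_rSeq h1).monotone hmn]

theorem tendsto_blockIndex (h : IsRegularWeight ω) (h1 : ∫ r in (0 : ℝ)..1, ω r = 1) :
    Tendsto (blockIndex ω) atTop atTop := by
  refine tendsto_nat_floor_atTop.comp ?_
  simp only [one_div]
  refine Tendsto.inv_tendsto_nhdsGT_zero ?_
  refine tendsto_nhdsWithin_iff.2 ⟨?_, Eventually.of_forall fun n => h.one_sub_rSeq_pos h1 n⟩
  simpa using (h.tendsto_rSeq h1).const_sub 1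

theorem lintegral_rSeq (h : IsRegularWeight ω) (h1 : ∫ r in (0 : ℝ)..1, ω r = 1) (n : ℕ) :
    ∫⁻ r in Ico (rSeq ω n) (rSeq ω (n + 1)), ENNReal.ofReal (ω r) =
      ENNReal.ofReal ((1 / 2) ^ (n + 1)) := by
  have hm := h.rSeq_mem h1 n
  have hm' := h.rSeq_mem h1 (n + 1)
  have hle : rSeq ω n ≤ rSeq ω (n + 1) := (h.strictMono_rSeq h1).monotone n.le_succ
  have hsub : Ico (rSeq ω n) (rSeq ω (n + 1)) ⊆ Ico 0 1 := Ico_subset_Ico hm.1 hm'.2.le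
  rw [← ofReal_integral_eq_lintegral_ofReal (h.integrableOn.mono_set hsub)
    ((ae_restrict_iff' measurableSet_Ico).2 (Eventually.of_forall fun r hr => (h.pos r (hsub hr)).le)),
    integral_Ico_eq_integral_Ioo, ← integral_Ioc_eq_integral_Ioo,
    ← intervalIntegral.integral_of_le hle]
  have hs : (∫ s in rSeq ω n..rSeq ω (n + 1), ω s) + tail ω (rSeq ω (n + 1)) = tail ω (rSeq ω n) :=
    intervalIntegral.integral_add_adjacent_intervals
      (h.intervalIntegrable (Ico_subset_Icc_self hm) (Ico_subset_Icc_self hm'))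
      (h.intervalIntegrable (Ico_subset_Icc_self hm') (right_mem_Icc.2 zero_le_one))
  rw [h.tail_rSeq h1, h.tail_rSeq h1] at hs
  congr 1
  rw [one_div_pow, eq_sub_of_add_eq hs, pow_succ]
  field_simp
  norm_num

theorem Ioo_subset_iUnion_rSeq (h : IsRegularWeight ω) (h1 : ∫ r in (0 : ℝ)..1, ω r = 1) :
    Ioo (0 : ℝ) 1 ⊆ ⋃ n, Ico (rSeq ω n) (rSeq ω (n + 1)) := by
  intro r hr
  have hex : ∃ n, r < rSeq ω n := ((h.tendsto_rSeq h1).eventually (lt_mem_nhds hr.2)).exists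
  classical
  have hne : Nat.find hex ≠ 0 := by
    intro h0
    have := Nat.find_spec hex
    rw [h0, h.rSeq_zero h1] at this
    exact absurd this (not_lt.2 hr.1.le)
  obtain ⟨n, hn⟩ := Nat.exists_eq_succ_of_ne_zero hne
  refine mem_iUnion.2 ⟨n, not_lt.1 (Nat.find_min hex (by omega)), ?_⟩
  have := Nat.find_spec hex
  rwa [hn] at this

end MixedNorm

/-! ### Geometrically decaying kernels on sequences. -/

/-- With truncated subtraction the exponent is |n - m|. The factor 2 is slack, and the bound is
infinite when μ ≥ 1. -/
theorem tsum_pow_dist_le (μ : ℝ≥0∞) (m : ℕ) :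
    ∑' n : ℕ, μ ^ ((n - m) + (m - n)) ≤ 2 * (1 - μ)⁻¹ * (1 + μ) := by
  have hgeom := ENNReal.tsum_geometric μ
  rw [← Summable.sum_add_tsum_nat_add' (f := fun n : ℕ => μ ^ ((n - m) + (m - n))) (k := m)
    ENNReal.summable]
  have e1 : ∑' i : ℕ, μ ^ ((i + m - m) + (m - (i + m))) = (1 - μ)⁻¹ := by
    rw [← hgeom]
    refine tsum_congr fun i => ?_
    congr 1; omega
  have e2 : ∑ i ∈ Finset.range m, μ ^ ((i - m) + (m - i)) ≤ μ * (1 - μ)⁻¹ := by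
    rw [← Finset.sum_range_reflect, ← hgeom, ← ENNReal.tsum_mul_left]
    refine le_trans (Finset.sum_le_sum fun i hi => ?_)
      (ENNReal.sum_le_tsum (f := fun i => μ * μ ^ i) (Finset.range m))
    rw [← pow_succ']
    refine le_of_eq ?_
    congr 1
    have := Finset.mem_range.1 hi
    omega
  rw [e1]
  calc _ ≤ μ * (1 - μ)⁻¹ + (1 - μ)⁻¹ := by gcongr
    _ = (1 - μ)⁻¹ * (1 + μ) := by ring
    _ ≤ _ := by rw [two_mul, add_mul]; exact le_self_add

/-- A geometrically decaying kernel is bounded on `ℓ^p` for every `p > 0`. -/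
theorem exists_tsum_convolution_rpow_le {p : ℝ} (hp : 0 < p) {μ : ℝ≥0∞} (hμ : μ < 1) :
    ∃ K : ℝ≥0∞, K ≠ ∞ ∧ ∀ a : ℕ → ℝ≥0∞,
      ∑' m : ℕ, (∑' n : ℕ, (μ ^ 2) ^ ((n - m) + (m - n)) * a n) ^ p ≤ K * ∑' n, a n ^ p := by
  set K₁ := 2 * (1 - μ)⁻¹ * (1 + μ) with hK₁
  set K₂ := 2 * (1 - μ ^ p)⁻¹ * (1 + μ ^ p) with hK₂
  have hfin : ∀ ν : ℝ≥0∞, ν < 1 → 2 * (1 - ν)⁻¹ * (1 + ν) ≠ ∞ := by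
    intro ν hν
    have h1 : (1 - ν)⁻¹ ≠ ∞ := ENNReal.inv_ne_top.2 (tsub_pos_of_lt hν).ne'
    have h2 : ν ≠ ∞ := hν.ne_top
    finiteness
  have h1 : K₁ ≠ ∞ := hfin μ hμ
  have h2 : K₂ ≠ ∞ := hfin _ (ENNReal.rpow_lt_one hμ hp)
  refine ⟨K₁ ^ p * K₂, ENNReal.mul_ne_top (ENNReal.rpow_ne_top_of_nonneg hp.le h1) h2,
    fun a => ?_⟩
  have inner : ∀ m : ℕ, (∑' n : ℕ, (μ ^ 2) ^ ((n - m) + (m - n)) * a n) ^ p ≤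
      K₁ ^ p * ∑' n : ℕ, (μ ^ p) ^ ((n - m) + (m - n)) * a n ^ p := by
    intro m
    set s := ∑' n : ℕ, (μ ^ p) ^ ((n - m) + (m - n)) * a n ^ p with hs
    -- The kernel is split into two factors μ^{|n-m|}: one bounds each term by s^{1/p}, the other
    -- makes the sum over n converge. No Hölder inequality is used, so p < 1 and p ≥ 1 are treated
    -- alike.
    have hle : ∀ n, μ ^ ((n - m) + (m - n)) * a n ≤ s ^ (1 / p) := by
      intro n
      rw [one_div, ENNReal.le_rpow_inv_iff hp, ENNReal.mul_rpow_of_nonneg _ _ hp.le]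
      have e : (μ ^ ((n - m) + (m - n))) ^ p = (μ ^ p) ^ ((n - m) + (m - n)) := by
        rw [← ENNReal.rpow_natCast, ← ENNReal.rpow_natCast, ← ENNReal.rpow_mul, ← ENNReal.rpow_mul,
          mul_comm]
      rw [e]
      exact ENNReal.le_tsum n
    have h3 : ∑' n : ℕ, (μ ^ 2) ^ ((n - m) + (m - n)) * a n ≤ K₁ * s ^ (1 / p) := by
      calc _ ≤ ∑' n : ℕ, μ ^ ((n - m) + (m - n)) * s ^ (1 / p) := by
            refine ENNReal.tsum_le_tsum fun n => ?_
            rw [pow_right_comm, sq, mul_assoc]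
            gcongr
            exact hle n
        _ = (∑' n : ℕ, μ ^ ((n - m) + (m - n))) * s ^ (1 / p) := ENNReal.tsum_mul_right
        _ ≤ _ := by gcongr; exact tsum_pow_dist_le μ m
    calc _ ≤ (K₁ * s ^ (1 / p)) ^ p := ENNReal.rpow_le_rpow h3 hp.le
      _ = K₁ ^ p * s := by
        rw [ENNReal.mul_rpow_of_nonneg _ _ hp.le, ← ENNReal.rpow_mul, one_div_mul_cancel hp.ne',
          ENNReal.rpow_one]
  calc _ ≤ ∑' m : ℕ, K₁ ^ p * ∑' n : ℕ, (μ ^ p) ^ ((n - m) + (m - n)) * a n ^ p :=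
        ENNReal.tsum_le_tsum inner
    _ = K₁ ^ p * ∑' n : ℕ, ∑' m : ℕ, (μ ^ p) ^ ((m - n) + (n - m)) * a n ^ p := by
        rw [ENNReal.tsum_mul_left, ENNReal.tsum_comm]
        simp only [add_comm]
    _ ≤ K₁ ^ p * ∑' n : ℕ, K₂ * a n ^ p := by
        gcongr with n
        rw [ENNReal.tsum_mul_right]
        gcongr
        exact tsum_pow_dist_le _ n
    _ = _ := by rw [ENNReal.tsum_mul_left, ← mul_assoc]

/-! ### Block decomposition of an analytic function and the kernel estimate. -/

namespace MixedNorm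

variable {ω : ℝ → ℝ}

theorem blockPoly_eq_coeffSum (ω : ℝ → ℝ) (n : ℕ) (g : ℂ → ℂ) :
    blockPoly ω n g = coeffSum (maclaurinCoeff g) (block ω n) := rfl

theorem block_eq_Ico (ω : ℝ → ℝ) (n : ℕ) :
    block ω n = Finset.Ico (if n = 0 then 0 else blockIndex ω n) (blockIndex ω (n + 1)) := by
  unfold block
  split_ifs with h
  · rw [h, Finset.range_eq_Ico]
  · rfl

theorem blockIndex_zero (h : IsRegularWeight ω) (h1 : ∫ r in (0 : ℝ)..1, ω r = 1) :
    blockIndex ω 0 = 1 := by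
  simp [blockIndex, h.rSeq_zero h1]

/-- The shift by one serves only the block n = 0, which contains k = 0 although M_0 = 1. -/
theorem blockIndex_sub_one_le (h : IsRegularWeight ω) (h1 : ∫ r in (0 : ℝ)..1, ω r = 1) {n k : ℕ}
    (hk : k ∈ block ω n) : blockIndex ω n - 1 ≤ k := by
  rw [block_eq_Ico, Finset.mem_Ico] at hk
  split_ifs at hk with h0
  · rw [h0, blockIndex_zero h h1]; omega
  · omega

theorem sum_coeffSum_block (h : IsRegularWeight ω) (h1 : ∫ r in (0 : ℝ)..1, ω r = 1) (a : ℕ → ℂ)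
    (K : ℕ) (z : ℂ) : ∑ n ∈ Finset.range (K + 1), coeffSum a (block ω n) z =
      coeffSum a (Finset.range (blockIndex ω (K + 1))) z := by
  induction K with
  | zero => simp [block]
  | succ K ih =>
    rw [Finset.sum_range_succ, ih, block, if_neg K.succ_ne_zero]
    exact Finset.sum_range_add_sum_Ico _ (monotone_blockIndex h h1 (Nat.le_succ _))

/-- Taylor sums cut at the indices M_{K+1} are sums of whole blocks and approximate g uniformly on
the circle, so Minkowski's inequality applies to them. -/
theorem circleNorm_le_tsum_block (h : IsRegularWeight ω) (h1 : ∫ r in (0 : ℝ)..1, ω r = 1) {q : ℝ}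
    (hq : 1 ≤ q) {g : ℂ → ℂ} (hg : DifferentiableOn ℂ g (Metric.ball 0 1)) {r : ℝ} (hr : 0 ≤ r)
    (hr1 : r < 1) : circleNorm q r g ≤ ∑' n, ENNReal.ofReal (r ^ (blockIndex ω n - 1)) *
      circleNorm q 1 (coeffSum (maclaurinCoeff g) (block ω n)) := by
  have hq0 : 0 < q := by linarith
  set a := maclaurinCoeff g
  refine ENNReal.le_of_forall_pos_le_add fun ε hε _ => ?_
  have hev := eventually_norm_sub_coeffSum_le hg hr hr1 (ε := ε) (by exact_mod_cast hε)
  obtain ⟨K, hK⟩ := (((tendsto_blockIndex h h1).comp (tendsto_add_atTop_nat 1)).eventually hev).exists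
  refine (circleNorm_le_add_of_norm_sub_le hq (continuous_circle_of_differentiableOn hg hr hr1)
    (continuous_circle_coeffSum _ _ _) hK).trans ?_
  rw [ENNReal.ofReal_coe_nnreal]
  gcongr
  have e : (fun θ : ℝ => coeffSum a (Finset.range (blockIndex ω (K + 1)))
      (r * Complex.exp (θ * Complex.I))) = ∑ n ∈ Finset.range (K + 1),
        fun θ : ℝ => coeffSum a (block ω n) (r * Complex.exp (θ * Complex.I)) := by
    funext θ
    rw [Finset.sum_apply, sum_coeffSum_block h h1]
  calc circleNorm q r (coeffSum a (Finset.range (blockIndex ω (K + 1))))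
      ≤ ∑ n ∈ Finset.range (K + 1), circleNorm q r (coeffSum a (block ω n)) := by
        unfold circleNorm
        rw [e]
        exact eLpNorm_sum_le (fun n _ => (continuous_circle_coeffSum _ _ _).aestronglyMeasurable)
          (by simpa using hq)
    _ ≤ ∑ n ∈ Finset.range (K + 1), ENNReal.ofReal (r ^ (blockIndex ω n - 1)) *
          circleNorm q 1 (coeffSum a (block ω n)) :=
        Finset.sum_le_sum fun n _ => circleNorm_coeffSum_le hq0 hr hr1.le a
          fun k hk => blockIndex_sub_one_le h h1 hk
    _ ≤ _ := ENNReal.sum_le_tsum _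

theorem exists_circleNorm_block_le_of_differentiableOn (h : IsRegularWeight ω)
    (h1 : ∫ r in (0 : ℝ)..1, ω r = 1) {q : ℝ} (hq : 1 < q) :
    ∃ C : ℝ≥0∞, C ≠ ∞ ∧ ∀ g : ℂ → ℂ, DifferentiableOn ℂ g (Metric.ball 0 1) → ∀ (r : ℝ), 0 ≤ r →
      r < 1 → ∀ n, circleNorm q r (coeffSum (maclaurinCoeff g) (block ω n)) ≤
        C * circleNorm q r g := by
  obtain ⟨C, hC, hle⟩ := exists_circleNorm_block_le hq
  refine ⟨C, hC, fun g hg r hr hr1 n => ?_⟩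
  have step : ∀ ε : ℝ, 0 < ε → circleNorm q r (coeffSum (maclaurinCoeff g) (block ω n)) ≤
      C * (circleNorm q r g + ENNReal.ofReal ε) := by
    intro ε hε
    obtain ⟨N, hN, hN'⟩ := ((eventually_norm_sub_coeffSum_le hg hr hr1 hε).and
      (eventually_ge_atTop (blockIndex ω (n + 1)))).exists
    have hmono := monotone_blockIndex h h1 n.le_succ
    rw [block_eq_Ico]
    refine (hle r _ _ _ N (by split_ifs <;> omega) hN').trans ?_
    gcongr
    refine circleNorm_le_add_of_norm_sub_le hq.le (continuous_circle_coeffSum _ _ _)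
      (continuous_circle_of_differentiableOn hg hr hr1) fun θ => ?_
    rw [norm_sub_rev]
    exact hN θ
  have ht : Tendsto (fun ε : ℝ => C * (circleNorm q r g + ENNReal.ofReal ε)) (𝓝[>] 0)
      (𝓝 (C * (circleNorm q r g + ENNReal.ofReal 0))) := by
    have hcont : Continuous fun ε : ℝ => C * (circleNorm q r g + ENNReal.ofReal ε) :=
      (ENNReal.continuous_const_mul hC).comp (continuous_const.add ENNReal.continuous_ofReal)
    exact (hcont.tendsto 0).mono_left nhdsWithin_le_nhds
  rw [ENNReal.ofReal_zero, add_zero] at ht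
  exact ge_of_tendsto ht (eventually_mem_nhdsWithin.mono fun ε hε => step ε hε)

/-- The weight `2^{-n} M_n^{-γ}` of the `n`-th block. -/
noncomputable def blockWeight (ω : ℝ → ℝ) (γ : ℝ) (n : ℕ) : ℝ := (1 / 2) ^ n * ((blockIndex ω n : ℝ) ^ γ)⁻¹

theorem blockIndex_pos (h : IsRegularWeight ω) (h1 : ∫ r in (0 : ℝ)..1, ω r = 1) (n : ℕ) :
    (0 : ℝ) < blockIndex ω n := by
  exact_mod_cast one_le_blockIndex h h1 n

theorem blockWeight_pos (h : IsRegularWeight ω) (h1 : ∫ r in (0 : ℝ)..1, ω r = 1) (γ : ℝ) (n : ℕ) :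
    0 < blockWeight ω γ n := by
  have := blockIndex_pos h h1 n
  unfold blockWeight
  positivity

theorem blockSum_eq (h : IsRegularWeight ω) (h1 : ∫ r in (0 : ℝ)..1, ω r = 1) {q : ℝ} (hq : 0 < q)
    (p γ : ℝ) (g : ℂ → ℂ) : blockSum q p γ ω g = ∑' n, ENNReal.ofReal (blockWeight ω γ n) *
      circleNorm q 1 (coeffSum (maclaurinCoeff g) (block ω n)) ^ p := by
  refine tsum_congr fun n => ?_
  have hM := blockIndex_pos h h1 n
  rw [blockPoly_eq_coeffSum, hardyNorm_coeffSum hq, blockWeight, ENNReal.ofReal_mul (by positivity),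
    ENNReal.ofReal_inv_of_pos (by positivity), ← ENNReal.ofReal_rpow_of_pos hM,
    ENNReal.ofReal_natCast, ENNReal.ofReal_pow (by positivity), div_eq_mul_inv, mul_assoc,
    mul_comm (_ ^ p)]
  congr 2
  rw [one_div, ENNReal.ofReal_inv_of_pos two_pos, ENNReal.ofReal_ofNat]

/-- Off-diagonal decay of the kernel relating the radii `r_{m+1}` and the blocks `I(n)`. -/
theorem exists_kernel_bound (h : IsRegularWeight ω) (h1 : ∫ r in (0 : ℝ)..1, ω r = 1) {γ u : ℝ}
    (hγ : 0 ≤ γ) (hu : 0 < u) : ∃ K : ℝ, 0 < K ∧ ∀ m n : ℕ,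
      rSeq ω (m + 1) ^ (blockIndex ω n - 1) * blockWeight ω γ m ^ u ≤
        K * (((1 / 2) ^ u) ^ ((n - m) + (m - n)) * blockWeight ω γ n ^ u) := by
  obtain ⟨a, b, ha, hb, hab⟩ := h.exists_ratio_bounds h1
  have hM := blockIndex_pos h h1
  have hW := blockWeight_pos h h1 γ
  set l : ℝ := (1 / 2) ^ u with hl
  have hlpos : 0 < l := by positivity
  -- `B` is the excess of the worst growth rate of the weights from n down to m over the required
  -- decay rate `l`. Its powers are dominated by exp(a^i), since B ≤ a^N for some N.
  set B := (2 * b ^ γ) ^ u / l with hB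
  have hBpos : 0 < B := by positivity
  obtain ⟨N, hN⟩ := pow_unbounded_of_one_lt B ha
  have hexp : ∀ i : ℕ, B ^ (i + 1) * Real.exp (-a ^ i) ≤ B * N.factorial := by
    intro i
    have h2 := Real.pow_div_factorial_le_exp (a ^ i) (by positivity) N
    have h3 : B ^ i ≤ (a ^ i) ^ N := by
      rw [← pow_mul, mul_comm, pow_mul]
      exact pow_le_pow_left₀ hBpos.le hN.le i
    have h4 : (0 : ℝ) < N.factorial := by exact_mod_cast N.factorial_pos
    rw [div_le_iff₀ h4] at h2
    rw [Real.exp_neg, pow_succ', mul_assoc]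
    refine mul_le_mul_of_nonneg_left ?_ hBpos.le
    rw [← div_eq_mul_inv, div_le_iff₀ (Real.exp_pos _)]
    linarith
  have hK0 : 0 ≤ Real.exp 2 * ((2 : ℝ) ^ γ) ^ u * (B * N.factorial) := by positivity
  refine ⟨1 + Real.exp 2 * ((2 : ℝ) ^ γ) ^ u * (B * N.factorial), by linarith, fun m n => ?_⟩
  have hr0 := (h.rSeq_mem h1 (m + 1)).1
  have hr1 := (h.rSeq_mem h1 (m + 1)).2
  -- For n ≤ m the power of the radius is bounded by 1 and the weights supply the decay; for n > m
  -- the weights may grow and the power must compensate.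
  rcases le_or_gt n m with hnm | hnm
  · obtain ⟨j, rfl⟩ := Nat.exists_eq_add_of_le hnm
    have hw : blockWeight ω γ (n + j) ≤ (1 / 2) ^ j * blockWeight ω γ n := by
      have h2 : ((blockIndex ω (n + j) : ℝ) ^ γ)⁻¹ ≤ ((blockIndex ω n : ℝ) ^ γ)⁻¹ := by
        have := hM n
        refine inv_anti₀ (by positivity) (Real.rpow_le_rpow this.le ?_ hγ)
        exact_mod_cast monotone_blockIndex h h1 (Nat.le_add_right n j)
      unfold blockWeight
      rw [pow_add, mul_comm ((1 / 2 : ℝ) ^ n), mul_assoc]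
      gcongr
    have hw' : blockWeight ω γ (n + j) ^ u ≤ l ^ j * blockWeight ω γ n ^ u := by
      refine (Real.rpow_le_rpow (hW _).le hw hu.le).trans_eq ?_
      rw [Real.mul_rpow (by positivity) (hW n).le, hl, ← Real.rpow_natCast, ← Real.rpow_natCast,
        ← Real.rpow_mul (by positivity), ← Real.rpow_mul (by positivity), mul_comm u]
    rw [show n - (n + j) + (n + j - n) = j by omega]
    have hpos : 0 ≤ l ^ j * blockWeight ω γ n ^ u :=
      mul_nonneg (by positivity) (Real.rpow_nonneg (hW n).le _)
    calc _ ≤ 1 * (l ^ j * blockWeight ω γ n ^ u) :=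
          mul_le_mul (pow_le_one₀ hr0 hr1.le) hw' (Real.rpow_nonneg (hW _).le _) zero_le_one
      _ ≤ _ := mul_le_mul_of_nonneg_right (by linarith) hpos
  · obtain ⟨i, rfl⟩ := Nat.exists_eq_add_of_lt hnm
    set n := m + i + 1 with hn
    have hxm := h.one_sub_rSeq_pos h1 m
    have hxn := h.one_sub_rSeq_pos h1 n
    have hx1 := h.one_sub_rSeq_pos h1 (m + 1)
    have hMn : (blockIndex ω n : ℝ) ≤ 2 * b ^ (i + 1) * blockIndex ω m := by
      have e1 := (hab m (i + 1)).2
      have e2 := blockIndex_le h h1 n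
      have e3 := one_lt_two_mul_blockIndex h h1 m
      rw [show m + (i + 1) = n by omega] at e1
      have e4 : (blockIndex ω n : ℝ) * (1 - rSeq ω n) ≤
          2 * b ^ (i + 1) * blockIndex ω m * (1 - rSeq ω n) := by
        have := mul_le_mul_of_nonneg_left e1 (by have := hM m; positivity :
          (0 : ℝ) ≤ 2 * blockIndex ω m)
        nlinarith
      exact le_of_mul_le_mul_right e4 hxn
    have hw : blockWeight ω γ m ≤ 2 ^ γ * (2 * b ^ γ) ^ (i + 1) * blockWeight ω γ n := by
      have e1 : (blockIndex ω n : ℝ) ^ γ ≤ 2 ^ γ * (b ^ γ) ^ (i + 1) * (blockIndex ω m : ℝ) ^ γ := by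
        refine (Real.rpow_le_rpow (hM n).le hMn hγ).trans_eq ?_
        rw [Real.mul_rpow (by positivity) (hM m).le, Real.mul_rpow (by norm_num) (by positivity),
          ← Real.rpow_natCast, ← Real.rpow_natCast, ← Real.rpow_mul (by positivity),
          ← Real.rpow_mul (by positivity), mul_comm γ]
      have p1 : 0 < (blockIndex ω n : ℝ) ^ γ := Real.rpow_pos_of_pos (hM n) _
      have p2 : 0 < (blockIndex ω m : ℝ) ^ γ := Real.rpow_pos_of_pos (hM m) _
      have e2 : ((blockIndex ω m : ℝ) ^ γ)⁻¹ ≤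
          2 ^ γ * (b ^ γ) ^ (i + 1) * ((blockIndex ω n : ℝ) ^ γ)⁻¹ := by
        rw [← div_eq_mul_inv, le_div_iff₀ p1, ← div_eq_inv_mul, div_le_iff₀ p2]
        exact e1
      unfold blockWeight
      calc (1 / 2 : ℝ) ^ m * ((blockIndex ω m : ℝ) ^ γ)⁻¹
          ≤ (1 / 2 : ℝ) ^ m * (2 ^ γ * (b ^ γ) ^ (i + 1) * ((blockIndex ω n : ℝ) ^ γ)⁻¹) := by gcongr
        _ = 2 ^ γ * (2 * b ^ γ) ^ (i + 1) * ((1 / 2) ^ n * ((blockIndex ω n : ℝ) ^ γ)⁻¹) := by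
          have : (1 / 2 : ℝ) ^ m = 2 ^ (i + 1) * (1 / 2) ^ n := by
            rw [hn, add_assoc, pow_add _ m, mul_left_comm, ← mul_pow]
            norm_num
          rw [this, mul_pow]
          ring
    have hw' : blockWeight ω γ m ^ u ≤ ((2 : ℝ) ^ γ) ^ u * (B * l) ^ (i + 1) *
        blockWeight ω γ n ^ u := by
      refine (Real.rpow_le_rpow (hW _).le hw hu.le).trans_eq ?_
      rw [Real.mul_rpow (by positivity) (hW n).le, Real.mul_rpow (by positivity) (by positivity),
        hB, div_mul_cancel₀ _ hlpos.ne', Real.rpow_pow_comm (by positivity)]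
    -- From r ≤ exp(-(1-r)) the exponent is -(M_n - 1)(1-r) = -(M_n + 1)(1-r) + 2(1-r), at most -a^i
    -- + 2.
    have hr : rSeq ω (m + 1) ^ (blockIndex ω n - 1) ≤ Real.exp 2 * Real.exp (-a ^ i) := by
      have e1 := (hab (m + 1) i).1
      rw [show m + 1 + i = n by omega] at e1
      have e2 := one_lt_blockIndex_add_one h h1 n
      have e3 : a ^ i ≤ (1 - rSeq ω (m + 1)) * (blockIndex ω n + 1) := by
        have p0 : (0 : ℝ) ≤ a ^ i := by positivity
        have p1 := hM n
        nlinarith [mul_le_mul_of_nonneg_right e1 (by linarith : (0 : ℝ) ≤ blockIndex ω n + 1)]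
      have e4 : rSeq ω (m + 1) ≤ Real.exp (-(1 - rSeq ω (m + 1))) := by
        have := Real.one_sub_le_exp_neg (1 - rSeq ω (m + 1))
        linarith
      refine (pow_le_pow_left₀ hr0 e4 _).trans ?_
      rw [← Real.exp_nat_mul, ← Real.exp_add, Real.exp_le_exp,
        Nat.cast_sub (one_le_blockIndex h h1 n)]
      push_cast
      nlinarith
    rw [show n - m + (m - n) = i + 1 by omega]
    have hWn : 0 ≤ blockWeight ω γ n ^ u := Real.rpow_nonneg (hW n).le _
    calc _ ≤ (Real.exp 2 * Real.exp (-a ^ i)) * (((2 : ℝ) ^ γ) ^ u * (B * l) ^ (i + 1) *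
          blockWeight ω γ n ^ u) :=
          mul_le_mul hr hw' (Real.rpow_nonneg (hW _).le _) (by positivity)
      _ = Real.exp 2 * ((2 : ℝ) ^ γ) ^ u * (B ^ (i + 1) * Real.exp (-a ^ i)) *
          (l ^ (i + 1) * blockWeight ω γ n ^ u) := by rw [mul_pow]; ring
      _ ≤ Real.exp 2 * ((2 : ℝ) ^ γ) ^ u * (B * N.factorial) *
          (l ^ (i + 1) * blockWeight ω γ n ^ u) := by
          exact mul_le_mul_of_nonneg_right
            (mul_le_mul_of_nonneg_left (hexp i) (by positivity)) (by positivity)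
      _ ≤ _ := mul_le_mul_of_nonneg_right (by linarith) (by positivity)

/-! ### The two norm inequalities. -/

theorem integralMean_nonneg (q r : ℝ) (f : ℂ → ℂ) : 0 ≤ integralMean q r f := by
  refine Real.rpow_nonneg (mul_nonneg (by positivity) ?_) _
  exact intervalIntegral.integral_nonneg Real.two_pi_pos.le fun θ _ => by positivity

theorem ofReal_integrand_eq {q p γ r : ℝ} (hq : 0 < q) (hp : 0 < p) (hr : r ∈ Ico (0 : ℝ) 1)
    {g : ℂ → ℂ} (hg : DifferentiableOn ℂ g (Metric.ball 0 1)) (ω : ℝ → ℝ) :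
    ENNReal.ofReal (integralMean q r g ^ p * (1 - r) ^ γ * ω r) =
      circleNorm q r g ^ p * ENNReal.ofReal ((1 - r) ^ γ) * ENNReal.ofReal (ω r) := by
  have h0 := integralMean_nonneg q r g
  have hx : 0 ≤ 1 - r := by linarith [hr.2]
  rw [ENNReal.ofReal_mul (by positivity), ENNReal.ofReal_mul (by positivity),
    ← ENNReal.ofReal_rpow_of_nonneg h0 hp.le,
    ofReal_integralMean hq (continuous_circle_of_differentiableOn hg hr.1 hr.2)]

theorem aemeasurable_ofReal (h : IsRegularWeight ω) (h1 : ∫ r in (0 : ℝ)..1, ω r = 1) (n : ℕ) :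
    AEMeasurable (fun r => ENNReal.ofReal (ω r))
      (volume.restrict (Ico (rSeq ω n) (rSeq ω (n + 1)))) :=
  (h.integrableOn.mono_set (Ico_subset_Ico (h.rSeq_mem h1 n).1
    (h.rSeq_mem h1 (n + 1)).2.le)).aestronglyMeasurable.aemeasurable.ennreal_ofReal

theorem exists_mixedIntegral_le (h : IsRegularWeight ω) (h1 : ∫ r in (0 : ℝ)..1, ω r = 1)
    {q p γ : ℝ} (hq : 1 < q) (hp : 0 < p) (hγ : 0 ≤ γ) : ∃ K : ℝ≥0∞, K ≠ ∞ ∧ ∀ g : ℂ → ℂ,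
      DifferentiableOn ℂ g (Metric.ball 0 1) →
      mixedIntegral q p γ ω g ≤ K * blockSum q p γ ω g := by
  have hq0 : 0 < q := by linarith
  obtain ⟨K₁, hK₁, hkernel⟩ := exists_kernel_bound h h1 hγ (one_div_pos.2 hp)
  -- Chosen so that `μ ^ 2` is the decay rate 2^{-1/p} of the kernel with u = 1/p.
  set μ : ℝ≥0∞ := ENNReal.ofReal ((1 / 2) ^ (1 / p / 2)) with hμ
  have hμ1 : μ < 1 := by
    rw [hμ, ENNReal.ofReal_lt_one]
    exact Real.rpow_lt_one (by norm_num) (by norm_num) (by positivity)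
  have hμ2 : μ ^ 2 = ENNReal.ofReal ((1 / 2) ^ (1 / p)) := by
    rw [hμ, ← ENNReal.ofReal_pow (by positivity), ← Real.rpow_natCast,
      ← Real.rpow_mul (by norm_num)]
    congr 2
    push_cast
    ring
  obtain ⟨K₂, hK₂, hconv⟩ := exists_tsum_convolution_rpow_le hp hμ1
  refine ⟨ENNReal.ofReal K₁ ^ p * K₂, ENNReal.mul_ne_top (ENNReal.rpow_ne_top_of_nonneg hp.le
    ENNReal.ofReal_ne_top) hK₂, fun g hg => ?_⟩
  set D : ℕ → ℝ≥0∞ := fun n => circleNorm q 1 (coeffSum (maclaurinCoeff g) (block ω n)) with hD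
  set S : ℕ → ℝ≥0∞ := fun m => ∑' n, ENNReal.ofReal (rSeq ω (m + 1) ^ (blockIndex ω n - 1)) * D n
  have hW := blockWeight_pos h h1 γ
  have piece : ∀ m, ∫⁻ r in Ico (rSeq ω m) (rSeq ω (m + 1)),
      ENNReal.ofReal (integralMean q r g ^ p * (1 - r) ^ γ * ω r) ≤
        S m ^ p * ENNReal.ofReal (blockWeight ω γ m) := by
    intro m
    have hM := blockIndex_pos h h1 m
    calc _ ≤ ∫⁻ r in Ico (rSeq ω m) (rSeq ω (m + 1)),
          S m ^ p * ENNReal.ofReal (((blockIndex ω m : ℝ) ^ γ)⁻¹) * ENNReal.ofReal (ω r) := by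
          refine setLIntegral_mono' measurableSet_Ico fun r hr => ?_
          have hr' : r ∈ Ico (0 : ℝ) 1 :=
            ⟨(h.rSeq_mem h1 m).1.trans hr.1, hr.2.trans (h.rSeq_mem h1 (m + 1)).2⟩
          rw [ofReal_integrand_eq hq0 hp hr' hg]
          gcongr
          · refine (circleNorm_le_tsum_block h h1 hq.le hg hr'.1 hr'.2).trans ?_
            refine ENNReal.tsum_le_tsum fun n => ?_
            gcongr
            exacts [hr'.1, hr.2.le]
          · rw [← Real.inv_rpow hM.le]
            refine Real.rpow_le_rpow (by linarith [hr'.2]) ?_ hγ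
            rw [← one_div, le_div_iff₀ hM]
            nlinarith [blockIndex_le h h1 m, hr.1]
      _ = S m ^ p * ENNReal.ofReal (((blockIndex ω m : ℝ) ^ γ)⁻¹) *
          ENNReal.ofReal ((1 / 2) ^ (m + 1)) := by
          rw [lintegral_const_mul'' _ (aemeasurable_ofReal h h1 m), lintegral_rSeq h h1]
      _ ≤ _ := by
          rw [mul_assoc, ← ENNReal.ofReal_mul (by positivity), blockWeight, mul_comm (_⁻¹)]
          exact mul_le_mul' le_rfl (ENNReal.ofReal_le_ofReal (mul_le_mul_of_nonneg_right
            (pow_le_pow_of_le_one (by norm_num) (by norm_num) m.le_succ) (by positivity)))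
  calc mixedIntegral q p γ ω g
      ≤ ∑' m, ∫⁻ r in Ico (rSeq ω m) (rSeq ω (m + 1)),
          ENNReal.ofReal (integralMean q r g ^ p * (1 - r) ^ γ * ω r) :=
        (lintegral_mono_set (Ioo_subset_iUnion_rSeq h h1)).trans (lintegral_iUnion_le _ _)
    _ ≤ ∑' m, S m ^ p * ENNReal.ofReal (blockWeight ω γ m) := ENNReal.tsum_le_tsum piece
    _ ≤ ∑' m, ENNReal.ofReal K₁ ^ p * (∑' n, (μ ^ 2) ^ ((n - m) + (m - n)) *
          (ENNReal.ofReal (blockWeight ω γ n ^ (1 / p)) * D n)) ^ p := by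
        refine ENNReal.tsum_le_tsum fun m => ?_
        -- Moving the weight inside the p-th power as W^{1/p} lets the kernel bound exchange the
        -- weight at m for the weight at n.
        have e : ENNReal.ofReal (blockWeight ω γ m) =
            ENNReal.ofReal (blockWeight ω γ m ^ (1 / p)) ^ p := by
          rw [ENNReal.ofReal_rpow_of_nonneg (Real.rpow_nonneg (hW m).le _) hp.le,
            ← Real.rpow_mul (hW m).le, one_div_mul_cancel hp.ne', Real.rpow_one]
        rw [e, ← ENNReal.mul_rpow_of_nonneg _ _ hp.le, ← ENNReal.mul_rpow_of_nonneg _ _ hp.le,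
          ← ENNReal.tsum_mul_right, ← ENNReal.tsum_mul_left]
        refine ENNReal.rpow_le_rpow (ENNReal.tsum_le_tsum fun n => ?_) hp.le
        have hk := ENNReal.ofReal_le_ofReal (hkernel m n)
        rw [ENNReal.ofReal_mul (pow_nonneg (h.rSeq_mem h1 (m + 1)).1 _), ENNReal.ofReal_mul hK₁.le,
          ENNReal.ofReal_mul (by positivity),
          ENNReal.ofReal_pow (Real.rpow_nonneg (by norm_num : (0 : ℝ) ≤ 1 / 2) (1 / p)), ← hμ2] at hk
        calc _ = ENNReal.ofReal (rSeq ω (m + 1) ^ (blockIndex ω n - 1)) *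
              ENNReal.ofReal (blockWeight ω γ m ^ (1 / p)) * D n := by ring
          _ ≤ ENNReal.ofReal K₁ * ((μ ^ 2) ^ ((n - m) + (m - n)) *
              ENNReal.ofReal (blockWeight ω γ n ^ (1 / p))) * D n := by gcongr
          _ = _ := by ring
    _ = ENNReal.ofReal K₁ ^ p * ∑' m, (∑' n, (μ ^ 2) ^ ((n - m) + (m - n)) *
          (ENNReal.ofReal (blockWeight ω γ n ^ (1 / p)) * D n)) ^ p := ENNReal.tsum_mul_left
    _ ≤ ENNReal.ofReal K₁ ^ p * (K₂ * ∑' n,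
          (ENNReal.ofReal (blockWeight ω γ n ^ (1 / p)) * D n) ^ p) := by
        gcongr
        exact hconv _
    _ = ENNReal.ofReal K₁ ^ p * K₂ * blockSum q p γ ω g := by
        rw [blockSum_eq h h1 hq0, mul_assoc]
        congr 3
        funext n
        rw [ENNReal.mul_rpow_of_nonneg _ _ hp.le,
          ENNReal.ofReal_rpow_of_nonneg (Real.rpow_nonneg (hW n).le _) hp.le,
          ← Real.rpow_mul (hW n).le, one_div_mul_cancel hp.ne', Real.rpow_one]

/-- On the annulus following `I(n)` the powers of the radius up to `M_{n+1}` stay bounded below. -/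
theorem exp_le_pow_blockIndex (h : IsRegularWeight ω) (h1 : ∫ r in (0 : ℝ)..1, ω r = 1) {n : ℕ}
    {r : ℝ} (hr : rSeq ω (n + 1) ≤ r) :
    Real.exp (-(1 / rSeq ω 1)) ≤ r ^ blockIndex ω (n + 1) := by
  have hr1 : 0 < rSeq ω 1 := by
    have := h.strictMono_rSeq h1 zero_lt_one
    rwa [h.rSeq_zero h1] at this
  have hle : rSeq ω 1 ≤ rSeq ω (n + 1) := (h.strictMono_rSeq h1).monotone (by omega)
  set s := rSeq ω (n + 1)
  have hs : 0 < s := hr1.trans_le hle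
  refine le_trans ?_ (pow_le_pow_left₀ hs.le hr _)
  rw [← Real.exp_log (pow_pos hs _), Real.exp_le_exp, Real.log_pow]
  -- With log s ≥ 1 - 1/s and M_{n+1}(1 - s) ≤ 1, the logarithm of s^{M_{n+1}} is at least -1/s.
  have e1 := Real.one_sub_inv_le_log_of_pos hs
  have e2 := blockIndex_le h h1 (n + 1)
  have hM := blockIndex_pos h h1 (n + 1)
  have e3 : -(1 / s) ≤ blockIndex ω (n + 1) * (1 - s⁻¹) := by
    have : (blockIndex ω (n + 1) : ℝ) * (1 - s⁻¹) = -(blockIndex ω (n + 1) * (1 - s) / s) := by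
      field_simp
      ring
    rw [this]
    exact neg_le_neg (div_le_div_of_nonneg_right e2 hs.le)
  have e4 : 1 / s ≤ 1 / rSeq ω 1 := one_div_le_one_div_of_le hr1 hle
  have e5 := mul_le_mul_of_nonneg_left e1 hM.le
  linarith

theorem exists_blockSum_le (h : IsRegularWeight ω) (h1 : ∫ r in (0 : ℝ)..1, ω r = 1)
    {q p γ : ℝ} (hq : 1 < q) (hp : 0 < p) (hγ : 0 ≤ γ) : ∃ K : ℝ≥0∞, K ≠ ∞ ∧ ∀ g : ℂ → ℂ,
      DifferentiableOn ℂ g (Metric.ball 0 1) →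
      blockSum q p γ ω g ≤ K * mixedIntegral q p γ ω g := by
  have hq0 : 0 < q := by linarith
  obtain ⟨C, hC, hproj⟩ := exists_circleNorm_block_le_of_differentiableOn h h1 hq
  obtain ⟨a, b, ha, hb, hab⟩ := h.exists_ratio_bounds h1
  set c₀ := ENNReal.ofReal (Real.exp (-(1 / rSeq ω 1))) with hc₀
  have hc₀0 : c₀ ≠ 0 := by simpa [hc₀] using Real.exp_pos _
  have hc₀t : c₀ ≠ ∞ := ENNReal.ofReal_ne_top
  set K₁ : ℝ≥0∞ := c₀⁻¹ * C with hK₁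
  have hK₁t : K₁ ≠ ∞ := ENNReal.mul_ne_top (ENNReal.inv_ne_top.2 hc₀0) hC
  set K₂ : ℝ := (2 * b ^ 2) ^ γ
  refine ⟨4 * (K₁ ^ p * ENNReal.ofReal K₂), ENNReal.mul_ne_top (by finiteness)
    (ENNReal.mul_ne_top (ENNReal.rpow_ne_top_of_nonneg hp.le hK₁t) ENNReal.ofReal_ne_top),
    fun g hg => ?_⟩
  set D : ℕ → ℝ≥0∞ := fun n => circleNorm q 1 (coeffSum (maclaurinCoeff g) (block ω n)) with hD
  set F : ℝ → ℝ≥0∞ := fun r => ENNReal.ofReal (integralMean q r g ^ p * (1 - r) ^ γ * ω r) with hF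
  -- Block n is tested on the annulus after r_{n+1}: its degrees stay below M_{n+1}, and the radii
  -- stay above r_1 > 0, even for n = 0.
  set P : ℕ → Set ℝ := fun n => Ico (rSeq ω (n + 1)) (rSeq ω (n + 1 + 1)) with hP
  have hr1 : 0 < rSeq ω 1 := by
    have := h.strictMono_rSeq h1 zero_lt_one
    rwa [h.rSeq_zero h1] at this
  have hmem : ∀ n, ∀ r ∈ P n, r ∈ Ioo (0 : ℝ) 1 := fun n r hr =>
    ⟨(hr1.trans_le ((h.strictMono_rSeq h1).monotone (by omega))).trans_le hr.1,
      hr.2.trans (h.rSeq_mem h1 _).2⟩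
  have hDle : ∀ n, ∀ r ∈ P n, D n ≤ K₁ * circleNorm q r g := by
    intro n r hr
    have hr' := hmem n r hr
    have e1 := le_circleNorm_coeffSum hq0 hr'.1 hr'.2.le (maclaurinCoeff g)
      (N := blockIndex ω (n + 1)) (s := block ω n) fun k hk => by
        rw [block_eq_Ico, Finset.mem_Ico] at hk
        exact hk.2.le
    have e2 : c₀ * D n ≤ C * circleNorm q r g := by
      refine le_trans ?_ (e1.trans (hproj g hg r hr'.1.le hr'.2 n))
      gcongr
      exact ENNReal.ofReal_le_ofReal (exp_le_pow_blockIndex h h1 hr.1)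
    calc D n = c₀⁻¹ * (c₀ * D n) := by
          rw [← mul_assoc, ENNReal.inv_mul_cancel hc₀0 hc₀t, one_mul]
      _ ≤ c₀⁻¹ * (C * circleNorm q r g) := by gcongr
      _ = _ := by rw [hK₁, mul_assoc]
  -- 1/M_n < 2(1 - r_n) ≤ 2b²(1 - r_{n+2}) ≤ 2b²(1 - r), which is the source of `K₂`.
  have hMle : ∀ n, ∀ r ∈ P n, ((blockIndex ω n : ℝ) ^ γ)⁻¹ ≤ K₂ * (1 - r) ^ γ := by
    intro n r hr
    have hM := blockIndex_pos h h1 n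
    have hx : 0 < 1 - r := by linarith [(hmem n r hr).2]
    rw [← Real.mul_rpow (by positivity) hx.le, ← Real.inv_rpow hM.le]
    refine Real.rpow_le_rpow (by positivity) ?_ hγ
    have e1 := (hab n 2).2
    have e2 := one_lt_two_mul_blockIndex h h1 n
    have e3 : 1 - rSeq ω (n + 2) ≤ 1 - r := by
      have : r < rSeq ω (n + 2) := hr.2
      linarith
    have e4 : 1 - rSeq ω n ≤ b ^ 2 * (1 - r) :=
      e1.trans (mul_le_mul_of_nonneg_left e3 (by positivity))
    rw [← one_div, div_le_iff₀ hM]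
    nlinarith [mul_le_mul_of_nonneg_left e4 hM.le]
  have term : ∀ n, ENNReal.ofReal (blockWeight ω γ n) * D n ^ p ≤
      4 * (K₁ ^ p * ENNReal.ofReal K₂) * ∫⁻ r in P n, F r := by
    intro n
    have hM := blockIndex_pos h h1 n
    -- The annulus `P n` has ω-mass 2^{-(n+2)}, hence the factor 4.
    have e : ENNReal.ofReal (blockWeight ω γ n) =
        4 * (ENNReal.ofReal (((blockIndex ω n : ℝ) ^ γ)⁻¹) *
          ENNReal.ofReal ((1 / 2) ^ (n + 1 + 1))) := by
      rw [← ENNReal.ofReal_mul (by positivity), ← ENNReal.ofReal_ofNat 4,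
        ← ENNReal.ofReal_mul (by norm_num), blockWeight]
      congr 1
      rw [pow_succ, pow_succ]
      ring
    rw [e, ← lintegral_rSeq h h1 (n + 1)]
    calc _ = 4 * (D n ^ p * ENNReal.ofReal (((blockIndex ω n : ℝ) ^ γ)⁻¹) *
          ∫⁻ r in P n, ENNReal.ofReal (ω r)) := by ring
      _ = 4 * ∫⁻ r in P n, D n ^ p * ENNReal.ofReal (((blockIndex ω n : ℝ) ^ γ)⁻¹) *
          ENNReal.ofReal (ω r) := by
          rw [lintegral_const_mul'' _ (aemeasurable_ofReal h h1 (n + 1))]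
      _ ≤ 4 * ∫⁻ r in P n, (K₁ ^ p * ENNReal.ofReal K₂) * F r := by
          gcongr 4 * ?_
          refine setLIntegral_mono' measurableSet_Ico fun r hr => ?_
          have hr' := Ioo_subset_Ico_self (hmem n r hr)
          rw [hF]
          simp only
          rw [ofReal_integrand_eq hq0 hp hr' hg]
          calc _ ≤ (K₁ * circleNorm q r g) ^ p * ENNReal.ofReal (K₂ * (1 - r) ^ γ) *
                ENNReal.ofReal (ω r) := by
                gcongr
                exacts [hDle n r hr, hMle n r hr]
            _ = _ := by
                rw [ENNReal.mul_rpow_of_nonneg _ _ hp.le, ENNReal.ofReal_mul (by positivity)]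
                ring
      _ = _ := by
          rw [lintegral_const_mul' _ _ (ENNReal.mul_ne_top (ENNReal.rpow_ne_top_of_nonneg hp.le hK₁t)
            ENNReal.ofReal_ne_top)]
          ring
  have hdisj : Pairwise (Function.onFun Disjoint P) :=
    Monotone.pairwise_disjoint_on_Ico_succ (f := fun n => rSeq ω (n + 1))
      fun m n hmn => (h.strictMono_rSeq h1).monotone (Nat.add_le_add_right hmn 1)
  rw [blockSum_eq h h1 hq0]
  calc _ ≤ ∑' n, 4 * (K₁ ^ p * ENNReal.ofReal K₂) * ∫⁻ r in P n, F r := ENNReal.tsum_le_tsum term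
    _ = 4 * (K₁ ^ p * ENNReal.ofReal K₂) * ∫⁻ r in ⋃ n, P n, F r := by
        rw [ENNReal.tsum_mul_left, lintegral_iUnion (fun n => measurableSet_Ico) hdisj]
    _ ≤ _ := by
        gcongr
        exact lintegral_mono_set (iUnion_subset fun n r hr => hmem n r hr)

end MixedNorm

theorem mainTheorem10 (q p γ : ℝ) (hq : 1 < q) (hp : 0 < p) (hγ : 0 ≤ γ)
    (ω : ℝ → ℝ) (hω : MixedNorm.IsRegularWeight ω) (hmass : ∫ r in (0 : ℝ)..1, ω r = 1) :
    ∃ C : ℝ, 0 < C ∧ ∀ g : ℂ → ℂ, DifferentiableOn ℂ g (Metric.ball (0 : ℂ) 1) →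
      MixedNorm.mixedNorm q p γ ω g ^ p =
          ∫⁻ r in Set.Ioo (0 : ℝ) 1,
            ENNReal.ofReal (MixedNorm.integralMean q r g ^ p * (1 - r) ^ γ * ω r) ∧
        MixedNorm.mixedNorm q p γ ω g ^ p ≤
          ENNReal.ofReal C * MixedNorm.blockSum q p γ ω g ∧
        MixedNorm.blockSum q p γ ω g ≤
          ENNReal.ofReal C * MixedNorm.mixedNorm q p γ ω g ^ p := by
  obtain ⟨K, hK, hupper⟩ := MixedNorm.exists_mixedIntegral_le hω hmass hq hp hγ
  obtain ⟨L, hL, hlower⟩ := MixedNorm.exists_blockSum_le hω hmass hq hp hγ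
  have hnorm : ∀ g, MixedNorm.mixedNorm q p γ ω g ^ p = MixedNorm.mixedIntegral q p γ ω g := by
    intro g
    rw [MixedNorm.mixedNorm, ← ENNReal.rpow_mul, one_div_mul_cancel hp.ne', ENNReal.rpow_one]
  refine ⟨K.toReal + L.toReal + 1, by positivity, fun g hg => ⟨hnorm g, ?_, ?_⟩⟩
  · rw [hnorm]
    refine (hupper g hg).trans ?_
    gcongr
    exact ENNReal.le_ofReal_iff_toReal_le hK (by positivity) |>.2
      (by linarith [ENNReal.toReal_nonneg (a := L)])
  · rw [hnorm]
    refine (hlower g hg).trans ?_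
    gcongr
    exact ENNReal.le_ofReal_iff_toReal_le hL (by positivity) |>.2
      (by linarith [ENNReal.toReal_nonneg (a := K)])
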